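/- Let $X$ be a compact Hausdorff space and let $A\subseteq C(X)$ be a uniform algebra, i.e. a uniformly closed subalgebra of the algebra $C(X)$ of complex-valued continuous functions that contains the constants and separates the points of $X$. Let $\varphi$ be a nonzero multiplicative linear functional on $A$, and let $M_\varphi$ be the set of representing measures for $\varphi$, i.e. of the positive (finite, regular Borel) measures $\mu$ on $X$ with $\varphi(f)=\int f\,d\mu$ for all $f\in A$. Suppose that $M_\varphi$ is finite dimensional, and that $m$ is a core measure for $\varphi$: $m\in M_\varphi$, and whenever $\nu$ is a real measure with $m+\nu\in M_\varphi$, then $m-\varepsilon\nu\in M_\varphi$ for all sufficiently small $\varepsilon>0$. A linear subspace $\mathcal M$ of $L^r(m)$ (complex-valued functions) is called invariant if $A\mathcal M\subseteq\mathcal M$. Let $0<p<q\le\infty$. Then there is a one-to-one correspondence (a bijection) $\mathcal M_p\leftrightarrow\mathcal M_q$ between the closed invariant subspaces $\mathcal M_p$ of $L^p(m)$ and the closed (weak-star closed, with respect to the duality $L^\infty(m)=L^1(m)^*$, if $q=\infty$) invariant subspaces $\mathcal M_q$ of $L^q(m)$ such that $$\mathcal M_q=\mathcal M_p\cap L^q(m)\qquad\text{and}\qquad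 \mathcal M_p\text{ is the closure of }\mathcal M_q\text{ in }L^p(m).$$ Here, for $0<p<1$, $L^p(m)$ carries the metric $\int|f-g|^p\,dm$. -/

import Mathlib

open MeasureTheory Filter Topology
open scoped ENNReal

noncomputable section

namespace UniformAlgebra

/-- A uniform algebra on a compact Hausdorff space `X`: a subalgebra of `C(X, ℂ)` (it contains the
constants) that is closed in the uniform norm and separates the points of `X`. -/
structure IsUniformAlgebra {X : Type*} [TopologicalSpace X] [CompactSpace X]
    (A : Subalgebra ℂ C(X, ℂ)) : Prop where
  isClosed : IsClosed (A : Set C(X, ℂ))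
  separatesPoints : A.SeparatesPoints

/-- `x` is a core point of the subset `W` of a real vector space: `x ∈ W`, and whenever
`x + y ∈ W`, one has `x - ε y ∈ W` for all sufficiently small `ε > 0`. -/
def IsCorePoint {V : Type*} [AddCommGroup V] [Module ℝ V] (W : Set V) (x : V) : Prop :=
  x ∈ W ∧ ∀ y : V, x + y ∈ W → ∀ᶠ ε in 𝓝[>] (0 : ℝ), x - ε • y ∈ W

variable {X : Type*} [TopologicalSpace X] [CompactSpace X] [MeasurableSpace X] [BorelSpace X]

/-- `m` is a representing measure for `φ`: a finite positive regular Borel measure on `X` with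
`φ f = ∫ f dm` for all `f ∈ A`. -/
structure IsRepresentingMeasure {A : Subalgebra ℂ C(X, ℂ)} (φ : A →ₐ[ℂ] ℂ) (m : Measure X) :
    Prop where
  isFinite : IsFiniteMeasure m
  regular : m.Regular
  integral_eq : ∀ f : A, φ f = ∫ x, (f : C(X, ℂ)) x ∂m

/-- The set of all representing measures for `φ`, inside the real vector space of finite signed
measures on `X`. -/
def representingMeasures {A : Subalgebra ℂ C(X, ℂ)} (φ : A →ₐ[ℂ] ℂ) : Set (SignedMeasure X) :=
  {s | ∃ (m : Measure X) (_ : IsFiniteMeasure m),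
    IsRepresentingMeasure φ m ∧ s = m.toSignedMeasure}

/-- `m` is a core measure for `φ`: a core point of the set of representing measures. -/
def IsCoreMeasure {A : Subalgebra ℂ C(X, ℂ)} (φ : A →ₐ[ℂ] ℂ) (m : Measure X)
    [IsFiniteMeasure m] : Prop :=
  IsCorePoint (representingMeasures φ) m.toSignedMeasure

/-- The closure in `L^p(m)` of a set `S` of (classes of) functions. For `1 ≤ p` it is the closure
in the norm, for `0 < p < 1` the closure for the metric `∫ |f - g| ^ p dm`. -/
def lpClosure (p : ℝ≥0∞) (m : Measure X) (S : Set (X →ₘ[m] ℂ)) : Set (X →ₘ[m] ℂ) :=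
  {f | f ∈ Lp ℂ p m ∧ ∀ ε : ℝ≥0∞, 0 < ε → ∃ g ∈ S, eLpNorm (f - g : X →ₘ[m] ℂ) p m < ε}

/-- The weak-star topology of `L^∞(m)` as the dual of `L^1(m)`: the coarsest topology for which
`f ↦ ∫ f g dm` is continuous for every `g ∈ L^1(m)`. -/
@[reducible] def weakStarTopology (m : Measure X) : TopologicalSpace (Lp ℂ ∞ m) :=
  TopologicalSpace.induced (fun f (g : Lp ℂ 1 m) => ∫ x, f x * g x ∂m) inferInstance

/-- A subspace contained in `L^p(m)` is closed: weak-star closed if `p = ∞`, closed in `L^p(m)`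
if `p < ∞`. -/
def IsClosedIn (p : ℝ≥0∞) (m : Measure X) (M : Submodule ℂ (X →ₘ[m] ℂ)) : Prop :=
  (p = ∞ → IsClosed[weakStarTopology m] {f : Lp ℂ ∞ m | (f : X →ₘ[m] ℂ) ∈ M}) ∧
  (p ≠ ∞ → lpClosure p m (M : Set (X →ₘ[m] ℂ)) ⊆ M)

/-- The closed (weak-star closed if `p = ∞`) linear subspaces `M` of `L^p(m)` that are invariant
under `A`, i.e. `A M ⊆ M`. -/
def closedInvariantSubspaces (A : Subalgebra ℂ C(X, ℂ)) (p : ℝ≥0∞) (m : Measure X) :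
    Set (Submodule ℂ (X →ₘ[m] ℂ)) :=
  {M | M ≤ Lp.LpSubmodule ℂ ℂ p m ∧ IsClosedIn p m M ∧
    ∀ a ∈ A, ∀ f ∈ M, ContinuousMap.toAEEqFun m a * f ∈ M}

end UniformAlgebra

end

/-! Everything rests on multipliers from `A` that cut functions down to size yet stay close to `1`.
Since `m` is a core point of a finite dimensional convex set, one `δ > 0` makes `m - δ (μ - m)` a
representing measure for every representing `μ`; positivity then gives `μ ≤ C m`
(`IsCoreMeasure.exists_le_smul`). By Hahn-Banach and Riesz, the infimum of `Re φ a` over `Re a ≥ v`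
equals `∫ v dμ` for some representing `μ` (`exists_representingMeasure_integral_le`), so for `v ≥ 0`
it is at most `C ∫ v dm`. Exponentiating `-a` gives `h ∈ A` with `|h| ≤ exp (-v)` and `∫ |1 - h|²
dm` bounded by a multiple of `∫ v dm`, up to an arbitrarily small error. Infinite products extend
this to integrable `u ≥ 0`, with bounded limits of `A` in place of `h`. Taking `u = log (1 + |w n|)`
with `w n → 0` in `L^p` yields, along a subsequence, `G n → 1` a.e. with `|G n| ≤ 1 / (1 + |w n|)`.
Two choices of `w` prove the theorem. If `g n → f` in `L^p` with `f ∈ L^q` and `w n = f - g n`, then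
`G n * g n` is dominated by `1 + |f|` and tends to `f`, so taking the `L^p` closure adds nothing
inside `L^q` (`IsCoreMeasure.mem_of_mem_lpClosure`). If `w n = f / (n + 1)`, then `G n * f` is
bounded and tends to `f` in `L^p`, so bounded functions are dense
(`IsCoreMeasure.subset_lpClosure_inf_Lp`). -/

namespace UniformAlgebra

/-! ### Core points and domination of representing measures. -/

/-- A core point of a convex set whose affine span is finite dimensional admits a uniform `ε`,
as soon as the set is bounded with respect to a separating family of linear functionals. -/
theorem IsCorePoint.exists_uniform {V ι : Type*} [AddCommGroup V] [Module ℝ V] {W : Set V} {x : V}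
    (hx : IsCorePoint W x) (hW : Convex ℝ W) (hfin : FiniteDimensional ℝ (vectorSpan ℝ W))
    (F : V →ₗ[ℝ] ι → ℝ) (hF : Function.Injective F) (hb : ∀ w ∈ W, ∀ i, |F w i| ≤ 1) :
    ∃ δ : ℝ, 0 < δ ∧ ∀ w ∈ W, x - δ • (w - x) ∈ W := by
  classical
  set D : Set V := (fun w => w - x) '' W with hD
  have hspan : vectorSpan ℝ W = Submodule.span ℝ D :=
    vectorSpan_eq_span_vsub_set_right ℝ hx.1
  obtain ⟨b, hbD, hbspan, hbli⟩ := exists_linearIndependent ℝ D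
  rw [hspan, ← hbspan] at hfin
  have hbfin : Finite b := by
    have h2 : LinearIndependent ℝ
        (fun i : b => (⟨i, Submodule.subset_span i.2⟩ : Submodule.span ℝ b)) :=
      LinearIndependent.of_comp (Submodule.span ℝ b).subtype hbli
    exact h2.finite
  have : Fintype b := Fintype.ofFinite b
  let T : (b → ℝ) →ₗ[ℝ] V := Fintype.linearCombination ℝ (fun i : b => (i : V))
  have hT : Function.Injective T :=
    linearIndependent_iff_injective_fintypeLinearCombination.1 hbli
  have hTapp : ∀ c, T c = ∑ i, c i • (i : V) := fun c => rfl
  -- Injective linear maps out of a finite dimensional space are closed embeddings, so a box has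
  -- compact preimage. This bounds the coordinates of all `w - x` at once; the box has radius 2
  -- because `F w` and `F x` have entries in `[-1, 1]`.
  have hcl : IsClosedEmbedding (F.comp T) :=
    LinearMap.isClosedEmbedding_of_injective (LinearMap.ker_eq_bot.2 (by
      rw [LinearMap.coe_comp]; exact hF.comp hT))
  have hcomp : IsCompact ((F.comp T) ⁻¹' (Set.pi Set.univ fun _ => Set.Icc (-2 : ℝ) 2)) :=
    hcl.isCompact_preimage (isCompact_univ_pi fun _ => isCompact_Icc)
  obtain ⟨R, hR⟩ := hcomp.isBounded.exists_norm_le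
  have hcoef : ∀ w ∈ W, ∃ c : b → ℝ, T c = w - x ∧ ∀ i, |c i| ≤ max R 1 := by
    intro w hw
    have hmem : w - x ∈ Submodule.span ℝ (Set.range ((↑) : b → V)) := by
      rw [Subtype.range_coe, hbspan]; exact Submodule.subset_span ⟨w, hw, rfl⟩
    obtain ⟨c, hc⟩ := (Submodule.mem_span_range_iff_exists_fun ℝ).1 hmem
    refine ⟨c, hc, fun i => le_max_of_le_left ?_⟩
    refine (norm_le_pi_norm c i).trans (hR c ?_)
    simp only [Set.mem_preimage, LinearMap.comp_apply, Set.mem_pi, Set.mem_univ, true_imp_iff]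
    intro j
    have hTc : T c = w - x := hc
    rw [hTc, map_sub, Pi.sub_apply]
    have h1 := abs_le.1 (hb w hw j)
    have h2 := abs_le.1 (hb x hx.1 j)
    constructor <;> linarith
  have hev : ∀ᶠ ε in 𝓝[>] (0 : ℝ), ∀ i : b, x - ε • (i : V) ∈ W := by
    rw [eventually_all]
    intro i
    obtain ⟨w, hw, hwi⟩ := hbD i.2
    refine hx.2 i ?_
    rw [← hwi]; simpa using hw
  obtain ⟨ε, hε, hεpos⟩ := (hev.and self_mem_nhdsWithin).exists
  have hεpos : 0 < ε := hεpos
  set n : ℝ := (Fintype.card b : ℝ) with hn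
  have hRpos : 0 < max R 1 := lt_max_of_lt_right one_pos
  have hnn : 0 ≤ n := Nat.cast_nonneg _
  -- The point `x - δ • (w - x)` is the average of the `n` points `x - (n δ c i) • i`, and this `δ`
  -- makes `|n δ c i| ≤ min ε 1`. Using `n + 1` keeps the denominator nonzero when `b` is empty.
  refine ⟨min ε 1 / ((n + 1) * max R 1), by positivity, fun w hw => ?_⟩
  set δ := min ε 1 / ((n + 1) * max R 1) with hδ
  obtain ⟨c, hc, hcR⟩ := hcoef w hw
  -- The segment from `x + i` to `x - ε • i` lies in `W`; it covers `-1 ≤ t ≤ ε`.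
  have hseg : ∀ i : b, ∀ t : ℝ, |t| ≤ min ε 1 → x - t • (i : V) ∈ W := by
    intro i t ht
    obtain ⟨w', hw', hwi⟩ := hbD i.2
    have hi : x + (i : V) ∈ W := by rw [← hwi]; simpa using hw'
    have ht1 := (le_abs_self t).trans (ht.trans (min_le_left _ _))
    have ht2 := (neg_le_abs t).trans (ht.trans (min_le_right _ _))
    have hs : 0 < ε + 1 := by linarith
    have := hW (hε i) hi (a := (1 + t) / (ε + 1)) (b := (ε - t) / (ε + 1))
      (div_nonneg (by linarith) hs.le) (div_nonneg (by linarith) hs.le) (by field_simp; ring)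
    convert this using 1
    rw [smul_sub, smul_add, smul_smul]
    match_scalars <;> field_simp <;> ring
  rcases isEmpty_or_nonempty b with hemp | hne
  · have : w - x = 0 := by rw [← hc, hTapp]; simp
    rw [this]; simpa using hx.1
  have hnpos : 0 < n := by rw [hn]; exact_mod_cast Fintype.card_pos
  have := hW.sum_mem (t := Finset.univ) (w := fun _ : b => 1 / n)
    (z := fun i : b => x - (n * δ * c i) • (i : V)) (fun _ _ => by positivity)
    (by rw [Finset.sum_const, Finset.card_univ, nsmul_eq_mul, ← hn,
        mul_one_div_cancel hnpos.ne']) (fun i _ => hseg i _ ?_)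
  · convert this using 1
    simp_rw [smul_sub, smul_smul, Finset.sum_sub_distrib]
    rw [← smul_sub, ← hc, hTapp, Finset.smul_sum]
    simp_rw [smul_smul]
    congr 1
    · rw [← Finset.sum_smul, Finset.sum_const, Finset.card_univ, nsmul_eq_mul, ← hn,
        mul_one_div_cancel hnpos.ne', one_smul]
    · refine Finset.sum_congr rfl fun i _ => ?_
      congr 1; field_simp
  · rw [abs_mul, abs_of_nonneg (by positivity)]
    calc n * δ * |c i| ≤ n * δ * max R 1 := by gcongr; exact hcR i
      _ = n / (n + 1) * min ε 1 := by rw [hδ]; field_simp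
      _ ≤ 1 * min ε 1 := by
        gcongr
        rw [div_le_one (by positivity)]; linarith
      _ = _ := one_mul _

variable {X : Type*} [TopologicalSpace X] [CompactSpace X] [MeasurableSpace X] [BorelSpace X]

theorem IsRepresentingMeasure.isProbabilityMeasure
    {X : Type*} [TopologicalSpace X] [MeasurableSpace X]
    {A : Subalgebra ℂ C(X, ℂ)} {φ : A →ₐ[ℂ] ℂ}
    {μ : Measure X} (h : IsRepresentingMeasure φ μ) : IsProbabilityMeasure μ := by
  have := h.isFinite
  have h1 := h.integral_eq 1
  simp only [map_one, OneMemClass.coe_one, ContinuousMap.one_apply, integral_const,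
    Complex.real_smul, mul_one] at h1
  have h2 : μ.real Set.univ = 1 := by exact_mod_cast h1.symm
  exact ⟨by rw [← ENNReal.toReal_eq_one_iff]; exact h2⟩

theorem IsCoreMeasure.isRepresentingMeasure {X : Type*} [TopologicalSpace X] [MeasurableSpace X]
    {A : Subalgebra ℂ C(X, ℂ)} {φ : A →ₐ[ℂ] ℂ}
    {m : Measure X} [IsFiniteMeasure m] (h : IsCoreMeasure φ m) : IsRepresentingMeasure φ m := by
  obtain ⟨m', _, hm', he⟩ := h.1
  rwa [Measure.toSignedMeasure_eq_toSignedMeasure_iff.1 he]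

theorem convex_representingMeasures [T2Space X] {A : Subalgebra ℂ C(X, ℂ)} (φ : A →ₐ[ℂ] ℂ) :
    Convex ℝ (representingMeasures φ) := by
  rintro _ ⟨μ, hμf, hμ, rfl⟩ _ ⟨ν, hνf, hν, rfl⟩ a b ha hb hab
  lift a to NNReal using ha
  lift b to NNReal using hb
  have := hμ.regular
  have := hν.regular
  refine ⟨a • μ + b • ν, inferInstance, ⟨inferInstance, inferInstance, fun f => ?_⟩, ?_⟩
  · have hint : ∀ (κ : Measure X) [IsFiniteMeasure κ],
        Integrable (fun x => (f : C(X, ℂ)) x) κ := fun κ _ =>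
      (f : C(X, ℂ)).continuous.integrable_of_hasCompactSupport (HasCompactSupport.of_compactSpace _)
    rw [integral_add_measure (hint _) (hint _), integral_smul_nnreal_measure,
      integral_smul_nnreal_measure, ← hμ.integral_eq, ← hν.integral_eq, ← add_smul]
    have : a + b = 1 := by exact_mod_cast hab
    rw [this, one_smul]
  · rw [Measure.toSignedMeasure_add, Measure.toSignedMeasure_smul, Measure.toSignedMeasure_smul]
    rfl

/-- If `φ` has a finite dimensional set of representing measures and `m` is a core measure, then
all representing measures are dominated by a fixed multiple of `m`. -/
theorem IsCoreMeasure.exists_le_smul [T2Space X] {A : Subalgebra ℂ C(X, ℂ)} {φ : A →ₐ[ℂ] ℂ}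
    {m : Measure X} [IsFiniteMeasure m] (hm : IsCoreMeasure φ m)
    (hφ : FiniteDimensional ℝ (vectorSpan ℝ (representingMeasures φ))) :
    ∃ C : NNReal, ∀ μ : Measure X, IsRepresentingMeasure φ μ → μ ≤ C • m := by
  let F : SignedMeasure X →ₗ[ℝ] Set X → ℝ :=
    { toFun := fun s i => s i
      map_add' := fun s t => by ext i; simp
      map_smul' := fun c s => by ext i; simp }
  obtain ⟨δ, hδ, h⟩ := hm.exists_uniform (convex_representingMeasures φ) hφ F
    (fun s t hst => VectorMeasure.ext fun i _ => congrFun hst i) (by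
      rintro _ ⟨μ, hμf, hμ, rfl⟩ i
      have := hμ.isProbabilityMeasure
      change |μ.toSignedMeasure i| ≤ 1
      rw [Measure.toSignedMeasure_apply]
      split_ifs
      · rw [abs_of_nonneg measureReal_nonneg]; exact measureReal_le_one
      · simp)
  -- Positivity of `m - δ (μ - m)` reads `δ μ ≤ (1 + δ) m`.
  refine ⟨Real.toNNReal ((1 + δ) / δ), fun μ hμ => Measure.le_iff.2 fun s hs => ?_⟩
  have := hμ.isFinite
  obtain ⟨m', hm'f, hm', he⟩ := h _ ⟨μ, inferInstance, hμ, rfl⟩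
  have h1 := congrArg (fun t : SignedMeasure X => t s) he
  simp only [FunLike.coe_sub, FunLike.coe_smul, Pi.sub_apply, Pi.smul_apply,
    Measure.toSignedMeasure_apply_measurable hs, smul_eq_mul] at h1
  have h2 : 0 ≤ m'.real s := measureReal_nonneg
  have h3 : μ.real s ≤ (1 + δ) / δ * m.real s := by
    rw [div_mul_eq_mul_div, le_div_iff₀ hδ]; linarith
  rw [Measure.smul_apply, ← ofReal_measureReal, ← ofReal_measureReal (μ := m),
    ENNReal.smul_def, smul_eq_mul, ← ENNReal.ofReal_coe_nnreal, ← ENNReal.ofReal_mul (by simp)]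
  apply ENNReal.ofReal_le_ofReal
  rwa [Real.coe_toNNReal _ (by positivity)]

/-! ### Duality between `Re A` and representing measures. -/

/-- Among the representing measures there is one which attains the infimum of `Re φ a` over
the `a ∈ A` with `v ≤ Re a`; in particular that infimum is controlled by representing measures. -/
theorem exists_representingMeasure_integral_le [T2Space X] {A : Subalgebra ℂ C(X, ℂ)}
    {φ : A →ₐ[ℂ] ℂ} {m : Measure X} (hm : IsRepresentingMeasure φ m) (v : C(X, ℝ)) :
    ∃ μ : Measure X, IsRepresentingMeasure φ μ ∧ ∀ c : ℝ, ∫ x, v x ∂μ < c →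
      ∃ a : A, (∀ x, v x ≤ ((a : C(X, ℂ)) x).re) ∧ (φ a).re < c := by
  have := hm.isProbabilityMeasure
  have hintR : ∀ f : C(X, ℝ), Integrable f m := fun f =>
    f.continuous.integrable_of_hasCompactSupport (HasCompactSupport.of_compactSpace _)
  have hintC : ∀ f : C(X, ℂ), Integrable f m := fun f =>
    f.continuous.integrable_of_hasCompactSupport (HasCompactSupport.of_compactSpace _)
  have hre : ∀ a : A, (φ a).re = ∫ x, ((a : C(X, ℂ)) x).re ∂m := fun a => by
    rw [hm.integral_eq]; exact (integral_re (hintC a)).symm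
  let S : C(X, ℝ) → Set ℝ := fun v =>
    {r | ∃ a : A, (∀ x, v x ≤ ((a : C(X, ℂ)) x).re) ∧ r = (φ a).re}
  have hbdd : ∀ v, BddBelow (S v) := by
    intro v
    refine ⟨∫ x, v x ∂m, ?_⟩
    rintro _ ⟨a, ha, rfl⟩
    rw [hre]
    exact integral_mono (hintR v) (hintC a).re ha
  have hne : ∀ v, (S v).Nonempty := by
    intro v
    refine ⟨_, algebraMap ℂ A (‖v‖ : ℂ), fun x => ?_, rfl⟩
    have := (le_abs_self _).trans (v.norm_coe_le_norm x)
    simpa using this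
  let N : C(X, ℝ) → ℝ := fun v => sInf (S v)
  have hN_le : ∀ v (a : A), (∀ x, v x ≤ ((a : C(X, ℂ)) x).re) → N v ≤ (φ a).re :=
    fun v a ha => csInf_le (hbdd v) ⟨a, ha, rfl⟩
  have hlt : ∀ v c, N v < c → ∃ a : A, (∀ x, v x ≤ ((a : C(X, ℂ)) x).re) ∧ (φ a).re < c := by
    intro v c hc
    obtain ⟨_, ⟨a, ha, rfl⟩, hac⟩ := exists_lt_of_csInf_lt (hne v) hc
    exact ⟨a, ha, hac⟩
  have hN_add : ∀ v w, N (v + w) ≤ N v + N w := by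
    intro v w
    refine le_of_forall_pos_lt_add fun ε hε => ?_
    obtain ⟨a, ha, hac⟩ := hlt v (N v + ε / 2) (by linarith)
    obtain ⟨b, hb, hbc⟩ := hlt w (N w + ε / 2) (by linarith)
    have := hN_le (v + w) (a + b) fun x => by
      simpa using add_le_add (ha x) (hb x)
    rw [show φ (a + b) = φ a + φ b from φ.toLinearMap.map_add a b, Complex.add_re] at this
    linarith
  have hN_smul_le : ∀ c : ℝ, 0 < c → ∀ v, N (c • v) ≤ c * N v := by
    intro c hc v
    refine le_of_forall_pos_lt_add fun ε hε => ?_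
    obtain ⟨a, ha, hac⟩ := hlt v (N v + ε / c) (by linarith [div_pos hε hc])
    have := hN_le (c • v) ((c : ℂ) • a) fun x => by
      simpa using mul_le_mul_of_nonneg_left (ha x) hc.le
    rw [show φ ((c : ℂ) • a) = (c : ℂ) • φ a from φ.toLinearMap.map_smul _ _, smul_eq_mul,
      Complex.re_ofReal_mul] at this
    calc _ ≤ c * (φ a).re := this
      _ < c * (N v + ε / c) := by gcongr
      _ = _ := by field_simp
  have hN_smul : ∀ c : ℝ, 0 < c → ∀ v, N (c • v) = c * N v := by
    intro c hc v
    refine le_antisymm (hN_smul_le c hc v) ?_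
    have := hN_smul_le c⁻¹ (inv_pos.2 hc) (c • v)
    rw [smul_smul, inv_mul_cancel₀ hc.ne', one_smul] at this
    calc c * N v ≤ c * (c⁻¹ * N (c • v)) := by gcongr
      _ = _ := by field_simp
  have hN0 : N 0 = 0 := by
    have := hN_smul 2 (by norm_num) 0
    rw [smul_zero] at this; linarith
  have hN_neg : ∀ v, -N v ≤ N (-v) := fun v => by
    have := hN_add v (-v)
    rw [add_neg_cancel, hN0] at this; linarith
  -- Hahn-Banach for the sublinear `N`, extending `t • v ↦ t * N v`; for `t < 0` the domination is
  -- `-N v ≤ N (-v)`.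
  obtain ⟨g, hgv, hgN⟩ : ∃ g : C(X, ℝ) →ₗ[ℝ] ℝ, g v = N v ∧ ∀ w, g w ≤ N w := by
    rcases eq_or_ne v 0 with rfl | hv
    · obtain ⟨g, -, hg⟩ := exists_extension_of_le_sublinear (⊥ : C(X, ℝ) →ₗ.[ℝ] ℝ) N hN_smul hN_add
        (by rintro ⟨x, hx⟩
            have : x = 0 := (Submodule.mem_bot ℝ).1 hx
            subst this
            rw [hN0]
            exact (LinearPMap.map_zero _).le)
      exact ⟨g, by rw [map_zero, hN0], hg⟩
    · obtain ⟨g, hg1, hg⟩ := exists_extension_of_le_sublinear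
        (LinearPMap.mkSpanSingleton v (N v) hv) N hN_smul hN_add (by
          rintro ⟨x, hx⟩
          obtain ⟨t, rfl⟩ := Submodule.mem_span_singleton.1 hx
          erw [LinearPMap.mkSpanSingleton'_apply]
          rcases lt_trichotomy t 0 with ht | rfl | ht
          · have h1 := hN_smul (-t) (by linarith) (-v)
            rw [neg_smul_neg] at h1
            simp only [smul_eq_mul, RingHom.id_apply]
            rw [h1]
            nlinarith [hN_neg v]
          · simp [hN0]
          · simp [hN_smul t ht])
      refine ⟨g, ?_, hg⟩
      have := hg1 ⟨v, Submodule.mem_span_singleton_self v⟩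
      rw [this]
      exact LinearPMap.mkSpanSingleton_apply ℝ ℝ hv (N v)
  have hgpos : ∀ w : C(X, ℝ), 0 ≤ w → 0 ≤ g w := by
    intro w hw
    have h1 := hgN (-w)
    have h2 := hN_le (-w) 0 fun x => by simpa using hw x
    simp only [map_neg, map_zero, Complex.zero_re] at h1 h2
    linarith
  let Λ : CompactlySupportedContinuousMap X ℝ →ₚ[ℝ] ℝ := PositiveLinearMap.mk₀
    { toFun := fun f => g f.toContinuousMap
      map_add' := fun f f' => g.map_add f.toContinuousMap f'.toContinuousMap
      map_smul' := fun c f => g.map_smul c f.toContinuousMap } (fun f hf => hgpos _ hf)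
  have hΛ : ∀ f : C(X, ℝ), ∫ x, f x ∂(RealRMK.rieszMeasure Λ) = g f := fun f =>
    RealRMK.integral_rieszMeasure Λ (CompactlySupportedContinuousMap.continuousMapEquiv f)
  let re : A → C(X, ℝ) := fun a => ⟨fun x => ((a : C(X, ℂ)) x).re, by fun_prop⟩
  -- Applied to both `a` and `-a`, this forces equality, so the Riesz measure of `g` represents `φ`;
  -- imaginary parts come from `-I • a`.
  have hgre_le : ∀ a : A, g (re a) ≤ (φ a).re := fun a =>
    (hgN _).trans (hN_le _ a fun x => le_rfl)
  have hgre : ∀ a : A, g (re a) = (φ a).re := by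
    intro a
    refine le_antisymm (hgre_le a) ?_
    have h1 := hgre_le (-a)
    have h2 : re (-a) = -re a := by ext x; simp [re]
    rw [h2] at h1
    simp only [map_neg, Complex.neg_re] at h1
    linarith
  refine ⟨RealRMK.rieszMeasure Λ, ⟨inferInstance, inferInstance, fun a => ?_⟩, fun c hc => ?_⟩
  · have hint : Integrable (fun x => (a : C(X, ℂ)) x) (RealRMK.rieszMeasure Λ) :=
      (a : C(X, ℂ)).continuous.integrable_of_hasCompactSupport (HasCompactSupport.of_compactSpace _)
    have h1 := hgre a
    have h2 := hgre (-Complex.I • a)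
    rw [← hΛ] at h1 h2
    have h1' := integral_re hint
    have h2' := integral_im hint
    apply Complex.ext
    · rw [← h1]; exact h1'
    · have h3 : (φ (-Complex.I • a)).re = (φ a).im := by
        rw [show φ (-Complex.I • a) = -Complex.I • φ a from φ.toLinearMap.map_smul _ _]; simp
      rw [← h3, ← h2]
      refine Eq.trans ?_ h2'
      congr 1; ext x; simp [re]
  · exact hlt v c (by rw [← hgv, ← hΛ]; exact hc)

/-! ### Exponentials in `A`: small multipliers close to `1`. -/

theorem integrable_continuousMap {E : Type*} [NormedAddCommGroup E]
    [SecondCountableTopologyEither X E] (m : Measure X) [IsFiniteMeasure m] (f : C(X, E)) :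
    Integrable f m :=
  f.continuous.integrable_of_hasCompactSupport (HasCompactSupport.of_compactSpace _)

theorem IsRepresentingMeasure.continuous
    {X : Type*} [TopologicalSpace X] [CompactSpace X] [MeasurableSpace X]
    {A : Subalgebra ℂ C(X, ℂ)} {φ : A →ₐ[ℂ] ℂ}
    {m : Measure X} (hm : IsRepresentingMeasure φ m) : Continuous φ := by
  have := hm.isProbabilityMeasure
  refine AddMonoidHomClass.continuous_of_bound φ.toLinearMap 1 fun f => ?_
  change ‖φ f‖ ≤ _
  rw [hm.integral_eq]
  refine (norm_integral_le_of_norm_le_const (C := ‖f‖)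
    (Eventually.of_forall fun x => (f : C(X, ℂ)).norm_coe_le_norm x)).trans_eq ?_
  rw [probReal_univ, mul_one, one_mul]

theorem algHom_exp {𝔸 : Type*} [NormedRing 𝔸] [NormedAlgebra ℂ 𝔸] [CompleteSpace 𝔸]
    (ψ : 𝔸 →ₐ[ℂ] ℂ) (hψ : Continuous ψ) (b : 𝔸) : ψ (NormedSpace.exp b) = Complex.exp (ψ b) := by
  let : NormedAlgebra ℚ 𝔸 := NormedAlgebra.restrictScalars ℚ ℂ 𝔸
  rw [Complex.exp_eq_exp_ℂ]
  exact NormedSpace.map_exp ψ hψ b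

/-- For `v ≥ 0` continuous there is `h ∈ A` with `|h| ≤ exp (-v)` and `φ h` close to `1`
as soon as `∫ v dm` is small. -/
theorem IsCoreMeasure.exists_norm_le_exp [T2Space X] {A : Subalgebra ℂ C(X, ℂ)}
    (hA : IsUniformAlgebra A) {φ : A →ₐ[ℂ] ℂ}
    (hφ : FiniteDimensional ℝ (vectorSpan ℝ (representingMeasures φ)))
    {m : Measure X} [IsFiniteMeasure m] (hm : IsCoreMeasure φ m) :
    ∃ C : ℝ, 0 ≤ C ∧ ∀ v : C(X, ℝ), 0 ≤ v → ∀ δ : ℝ, 0 < δ →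
      ∃ (h : A) (t : ℝ), (∀ x, ‖(h : C(X, ℂ)) x‖ ≤ Real.exp (-v x)) ∧
        φ h = (Real.exp (-t) : ℝ) ∧ t ≤ C * ∫ x, v x ∂m + δ := by
  obtain ⟨C, hC⟩ := hm.exists_le_smul hφ
  refine ⟨C, C.2, fun v hv δ hδ => ?_⟩
  obtain ⟨μ, hμ, h⟩ := exists_representingMeasure_integral_le hm.isRepresentingMeasure v
  have hle : ∫ x, v x ∂μ ≤ C * ∫ x, v x ∂m := by
    have h1 := integral_mono_measure (f := v) (hC μ hμ) (Eventually.of_forall hv)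
      (integrable_continuousMap _ v)
    rwa [integral_smul_nnreal_measure] at h1
  obtain ⟨a, ha, hac⟩ := h (C * ∫ x, v x ∂m + δ) (by linarith)
  -- The imaginary constant makes `φ b` real without changing `|exp b|`.
  let b : A := -a + algebraMap ℂ A ((φ a).im * Complex.I)
  have hcomplete : CompleteSpace A := hA.isClosed.completeSpace_coe
  have hexpx : ∀ x, ((NormedSpace.exp b : A) : C(X, ℂ)) x = Complex.exp ((b : C(X, ℂ)) x) := by
    intro x
    exact algHom_exp ((ContinuousMap.evalAlgHom ℂ ℂ x).comp A.val)
      ((ContinuousEvalConst.continuous_eval_const (F := C(X, ℂ)) x).comp continuous_subtype_val) b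
  refine ⟨NormedSpace.exp b, (φ a).re, fun x => ?_, ?_, hac.le⟩
  · rw [hexpx, Complex.norm_exp]
    apply Real.exp_le_exp.2
    have : ((b : C(X, ℂ)) x).re = - ((a : C(X, ℂ)) x).re := by simp [b]
    rw [this]; exact neg_le_neg (ha x)
  · rw [algHom_exp φ hm.isRepresentingMeasure.continuous b, Complex.ofReal_exp]
    congr 1
    have : φ b = -φ a + (φ a).im * Complex.I := by
      have h1 : φ b = φ (-a) + φ (algebraMap ℂ A ((φ a).im * Complex.I)) :=
        φ.toLinearMap.map_add _ _
      rw [h1, φ.commutes, show φ (-a) = -φ a from φ.toLinearMap.map_neg a]; rfl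
    rw [this]
    apply Complex.ext <;> simp

/-- Since `|h| ≤ 1`, `|1 - h|² ≤ 2 - 2 Re h`, whose integral is `2 - 2 exp (-t) ≤ 2 t`. -/
theorem IsRepresentingMeasure.integral_norm_one_sub_sq_le
    {A : Subalgebra ℂ C(X, ℂ)} {φ : A →ₐ[ℂ] ℂ} {m : Measure X} (hm : IsRepresentingMeasure φ m)
    (h : A) (h1 : ∀ x, ‖(h : C(X, ℂ)) x‖ ≤ 1) {t : ℝ} (ht : φ h = (Real.exp (-t) : ℝ)) :
    ∫ x, ‖1 - (h : C(X, ℂ)) x‖ ^ 2 ∂m ≤ 2 * t := by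
  have := hm.isProbabilityMeasure
  have hi := integrable_continuousMap m (h : C(X, ℂ))
  have hre : ∫ x, ((h : C(X, ℂ)) x).re ∂m = Real.exp (-t) := by
    have h2 : _ = (∫ x, (h : C(X, ℂ)) x ∂m).re := integral_re hi
    rw [← hm.integral_eq, ht, Complex.ofReal_re] at h2
    exact h2
  calc ∫ x, ‖1 - (h : C(X, ℂ)) x‖ ^ 2 ∂m ≤ ∫ x, (2 - 2 * ((h : C(X, ℂ)) x).re) ∂m := by
        refine integral_mono (integrable_continuousMap m
          (⟨fun x => ‖1 - (h : C(X, ℂ)) x‖ ^ 2, by fun_prop⟩ : C(X, ℝ)))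
          ((integrable_const _).sub (hi.re.const_mul 2)) fun x => ?_
        have h3 : ‖1 - (h : C(X, ℂ)) x‖ ^ 2
            = 1 - 2 * ((h : C(X, ℂ)) x).re + ‖(h : C(X, ℂ)) x‖ ^ 2 := by
          rw [← Complex.normSq_eq_norm_sq, ← Complex.normSq_eq_norm_sq, Complex.normSq_apply,
            Complex.normSq_apply]
          simp; ring
        have h4 := pow_le_one₀ (n := 2) (norm_nonneg _) (h1 x)
        simp only [h3]; linarith
    _ = 2 - 2 * Real.exp (-t) := by
        have h5 : Integrable (fun x => ((h : C(X, ℂ)) x).re) m := hi.re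
        rw [integral_sub (integrable_const _) (h5.const_mul 2), integral_const_mul, hre]
        simp
    _ ≤ 2 * t := by linarith [Real.add_one_le_exp (-t)]

/-! ### Infinite products: from continuous to integrable exponents. -/

/-- Density of `C(X)` in `L¹` at a geometric rate. Passing to an a.e. convergent subsequence keeps
the rate, since the `n`-th index is at least `n`. -/
theorem exists_continuousMap_tendsto_ae [T2Space X] (m : Measure X) [IsFiniteMeasure m]
    [m.Regular] {u : X → ℝ} (hu : 0 ≤ u) (hui : Integrable u m) {ε : ℝ} (hε : 0 < ε) :
    ∃ g : ℕ → C(X, ℝ), (∀ n, 0 ≤ g n) ∧ (∀ n, ∫ x, |g n x - u x| ∂m ≤ ε * (1 / 4) ^ n) ∧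
      ∀ᵐ x ∂m, Tendsto (fun n => g n x) atTop (𝓝 (u x)) := by
  have hex : ∀ n : ℕ, ∃ g : C(X, ℝ), 0 ≤ g ∧ ∫ x, |g x - u x| ∂m ≤ ε * (1 / 4) ^ n := by
    intro n
    obtain ⟨g, hg, hgi⟩ := hui.exists_boundedContinuous_integral_sub_le
      (ε := ε * (1 / 4) ^ n) (by positivity)
    refine ⟨g.toContinuousMap ⊔ 0, le_sup_right, le_trans ?_ hg⟩
    refine integral_mono ((integrable_continuousMap m (g.toContinuousMap ⊔ 0)).sub hui).norm
      (hui.sub hgi).norm fun x => ?_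
    have h0 : 0 ≤ u x := hu x
    change |max (g x) 0 - u x| ≤ |u x - g x|
    rw [abs_sub_comm (u x)]
    calc |max (g x) 0 - u x| = |max (g x) 0 - max (u x) 0| := by rw [max_eq_left h0]
      _ ≤ _ := abs_max_sub_max_le_abs _ _ _
  choose g hg0 hg using hex
  have hlim : Tendsto (fun n => ∫ x, |g n x - u x| ∂m) atTop (𝓝 0) := by
    refine squeeze_zero (fun n => integral_nonneg fun x => abs_nonneg _) hg ?_
    simpa using (tendsto_pow_atTop_nhds_zero_of_lt_one (r := (1 / 4 : ℝ)) (by norm_num)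
      (by norm_num)).const_mul ε
  have hmeas : TendstoInMeasure m (fun n => (g n : X → ℝ)) atTop u := by
    refine tendstoInMeasure_of_tendsto_eLpNorm one_ne_zero
      (fun n => (integrable_continuousMap m (g n)).1) hui.1 ?_
    have : ∀ n, eLpNorm ((g n : X → ℝ) - u) 1 m = ENNReal.ofReal (∫ x, |g n x - u x| ∂m) := by
      intro n
      rw [eLpNorm_one_eq_lintegral_enorm, ← ofReal_integral_norm_eq_lintegral_enorm
        ((integrable_continuousMap m (g n)).sub hui)]
      rfl
    simp_rw [this]
    simpa using ENNReal.tendsto_ofReal hlim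
  obtain ⟨ns, hns, hae⟩ := hmeas.exists_seq_tendsto_ae
  refine ⟨fun n => g (ns n), fun n => hg0 _, fun n => (hg _).trans ?_, hae⟩
  gcongr ε * ?_
  exact pow_le_pow_of_le_one (by norm_num) (by norm_num) (hns.id_le n)

/-- For `u ≥ 0` integrable there is a bounded pointwise limit `G` of functions in the unit ball
of `A` with `|G| ≤ exp (-u)`, which is close to `1` in `L²(m)` when `∫ u dm` is small. -/
theorem IsCoreMeasure.exists_limit_norm_le_exp [T2Space X] {A : Subalgebra ℂ C(X, ℂ)}
    (hA : IsUniformAlgebra A) {φ : A →ₐ[ℂ] ℂ}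
    (hφ : FiniteDimensional ℝ (vectorSpan ℝ (representingMeasures φ)))
    {m : Measure X} [IsFiniteMeasure m] (hm : IsCoreMeasure φ m) :
    ∃ K : ℝ, 0 ≤ K ∧ ∀ u : X → ℝ, 0 ≤ u → Integrable u m → ∀ ε : ℝ, 0 < ε →
      ∃ (H : ℕ → A) (G : X → ℂ), StronglyMeasurable G ∧
        (∀ n x, ‖(H n : C(X, ℂ)) x‖ ≤ 1) ∧
        (∀ᵐ x ∂m, Tendsto (fun n => (H n : C(X, ℂ)) x) atTop (𝓝 (G x))) ∧
        (∀ᵐ x ∂m, ‖G x‖ ≤ Real.exp (-u x)) ∧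
        ∫⁻ x, ‖G x - 1‖ₑ ^ 2 ∂m ≤ ENNReal.ofReal (K * (∫ x, u x ∂m + ε)) := by
  obtain ⟨C, hC0, hC⟩ := hm.exists_norm_le_exp hA hφ
  have hrep := hm.isRepresentingMeasure
  have := hrep.isProbabilityMeasure
  have := hrep.regular
  -- The factor `4 * C + 3` bounds the sum of the exponents `t k` (see `htsum`); the `2` comes from
  -- `∫ |1 - h|² ≤ 2 t`.
  refine ⟨2 * (4 * C + 3), by positivity, fun u hu hui ε hε => ?_⟩
  obtain ⟨g, hg0, hg, hgae⟩ := exists_continuousMap_tendsto_ae m hu hui hε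
  have hgi := fun n => integrable_continuousMap m (g n)
  -- Positive parts of the increments of `g`: the partial sums dominate `g n`, while the integrals
  -- decay geometrically after the first term.
  let v : ℕ → C(X, ℝ) := fun n => Nat.casesOn n (g 0) fun k => (g (k + 1) - g k) ⊔ 0
  have hv0 : ∀ n, 0 ≤ v n := by
    rintro (_ | n)
    · exact hg0 0
    · exact le_sup_right
  have hvsum : ∀ n x, g n x ≤ ∑ k ∈ Finset.range (n + 1), v k x := by
    intro n x
    induction n with
    | zero => simp [v]
    | succ n ih =>
      rw [Finset.sum_range_succ]
      have : g (n + 1) x - g n x ≤ v (n + 1) x := by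
        change _ ≤ max (g (n + 1) x - g n x) 0
        exact le_max_left _ _
      linarith
  have hvint0 : ∫ x, v 0 x ∂m ≤ ∫ x, u x ∂m + ε := by
    have h1 : ∫ x, v 0 x ∂m ≤ ∫ x, (u x + |g 0 x - u x|) ∂m := by
      refine integral_mono (hgi 0) (hui.add ((hgi 0).sub hui).norm) fun x => ?_
      have := le_abs_self (g 0 x - u x)
      change g 0 x ≤ u x + |g 0 x - u x|
      linarith
    have h3 : Integrable (fun x => |g 0 x - u x|) m := ((hgi 0).sub hui).norm
    rw [integral_add hui h3] at h1
    have h2 := hg 0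
    rw [pow_zero, mul_one] at h2
    linarith
  have hvint : ∀ n, ∫ x, v (n + 1) x ∂m ≤ 2 * ε * (1 / 4) ^ n := by
    intro n
    have h1 : ∫ x, v (n + 1) x ∂m ≤ ∫ x, (|g (n + 1) x - u x| + |g n x - u x|) ∂m := by
      refine integral_mono (integrable_continuousMap m _)
        (((hgi (n + 1)).sub hui).norm.add ((hgi n).sub hui).norm) fun x => ?_
      change max (g (n + 1) x - g n x) 0 ≤ |g (n + 1) x - u x| + |g n x - u x|
      have h1 := le_abs_self (g (n + 1) x - u x)
      have h2 := neg_le_abs (g n x - u x)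
      exact max_le (by linarith) (by positivity)
    have h5 : ∀ k, Integrable (fun x => |g k x - u x|) m := fun k => ((hgi k).sub hui).norm
    rw [integral_add (h5 _) (h5 _)] at h1
    have h2 := hg (n + 1)
    have h3 := hg n
    have h4 : ε * (1 / 4) ^ (n + 1) ≤ ε * (1 / 4) ^ n := by
      gcongr ε * ?_
      exact pow_le_pow_of_le_one (by norm_num) (by norm_num) (Nat.le_succ n)
    linarith
  choose h t hh hht ht using fun n => hC (v n) (hv0 n) (ε * (1 / 4) ^ n) (by positivity)
  have hh1 : ∀ n x, ‖(h n : C(X, ℂ)) x‖ ≤ 1 := fun n x =>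
    (hh n x).trans (Real.exp_le_one_iff.2 (neg_nonpos.2 (hv0 n x)))
  have ht0 : t 0 ≤ C * (∫ x, u x ∂m + ε) + ε := by
    have h1 := ht 0
    rw [pow_zero, mul_one] at h1
    nlinarith [mul_le_mul_of_nonneg_left hvint0 hC0]
  have htn : ∀ n, t (n + 1) ≤ (2 * C + 1) * ε * (1 / 4) ^ n := by
    intro n
    have h1 := ht (n + 1)
    have h2 := mul_le_mul_of_nonneg_left (hvint n) hC0
    have h4 : ε * (1 / 4) ^ (n + 1) ≤ ε * (1 / 4) ^ n := by
      gcongr ε * ?_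
      exact pow_le_pow_of_le_one (by norm_num) (by norm_num) (Nat.le_succ n)
    nlinarith
  have hu0 : 0 ≤ ∫ x, u x ∂m := integral_nonneg hu
  have htsum : ∀ n, ∑ k ∈ Finset.range (n + 1), t k ≤ (4 * C + 3) * (∫ x, u x ∂m + ε) := by
    have key : ∀ n, ∑ k ∈ Finset.range (n + 1), t k ≤
        C * (∫ x, u x ∂m + ε) + ε + (2 * C + 1) * ε * (4 / 3) * (1 - (1 / 4) ^ n) := by
      intro n
      induction n with
      | zero => simpa using ht0
      | succ n ih =>
        rw [Finset.sum_range_succ]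
        refine (add_le_add ih (htn n)).trans_eq ?_
        ring
    intro n
    refine (key n).trans ?_
    have h1 : (2 * C + 1) * ε * (4 / 3) * (1 - (1 / 4) ^ n) ≤ (2 * C + 1) * ε * (4 / 3) := by
      refine mul_le_of_le_one_right (by positivity) ?_
      have : (0 : ℝ) ≤ (1 / 4) ^ n := by positivity
      linarith
    nlinarith [mul_nonneg hC0 hε.le, mul_nonneg hC0 hu0]
  let H : ℕ → A := fun n => ∏ k ∈ Finset.range (n + 1), h k
  have hHx : ∀ n x, (H n : C(X, ℂ)) x = ∏ k ∈ Finset.range (n + 1), (h k : C(X, ℂ)) x := by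
    intro n x
    simp only [H]
    rw [← ContinuousMap.evalAlgHom_apply ℂ ℂ x, SubmonoidClass.coe_finsetProd, map_prod]
    rfl
  have hH1 : ∀ n x, ‖(H n : C(X, ℂ)) x‖ ≤ 1 := fun n x => by
    rw [hHx, norm_prod]
    exact Finset.prod_le_one (fun _ _ => norm_nonneg _) fun k _ => hh1 k x
  have hHg : ∀ n x, ‖(H n : C(X, ℂ)) x‖ ≤ Real.exp (-g n x) := fun n x => by
    rw [hHx, norm_prod]
    calc _ ≤ ∏ k ∈ Finset.range (n + 1), Real.exp (-v k x) :=
          Finset.prod_le_prod (fun _ _ => norm_nonneg _) fun k _ => hh k x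
      _ = Real.exp (-∑ k ∈ Finset.range (n + 1), v k x) := by
          rw [← Real.exp_sum, Finset.sum_neg_distrib]
      _ ≤ _ := Real.exp_le_exp.2 (neg_le_neg (hvsum n x))
  have hHφ : ∀ n, φ (H n) = (Real.exp (-∑ k ∈ Finset.range (n + 1), t k) : ℝ) := fun n => by
    simp only [H]
    rw [map_prod φ]
    simp_rw [hht]
    rw [← Finset.sum_neg_distrib, Real.exp_sum, Complex.ofReal_prod]
  have hHint : ∀ n, ∫⁻ x, ‖(H n : C(X, ℂ)) x - 1‖ₑ ^ 2 ∂m ≤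
      ENNReal.ofReal (2 * (4 * C + 3) * (∫ x, u x ∂m + ε)) := by
    intro n
    have h1 := hrep.integral_norm_one_sub_sq_le (H n) (hH1 n) (hHφ n)
    have hi : Integrable (fun x => ‖1 - (H n : C(X, ℂ)) x‖ ^ 2) m := integrable_continuousMap m
      (⟨fun x => ‖1 - (H n : C(X, ℂ)) x‖ ^ 2, by fun_prop⟩ : C(X, ℝ))
    have h2 : ∫⁻ x, ‖(H n : C(X, ℂ)) x - 1‖ₑ ^ 2 ∂m =
        ENNReal.ofReal (∫ x, ‖1 - (H n : C(X, ℂ)) x‖ ^ 2 ∂m) := by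
      rw [ofReal_integral_eq_lintegral_ofReal hi (Eventually.of_forall fun x => by positivity)]
      refine lintegral_congr fun x => ?_
      rw [ENNReal.ofReal_pow (norm_nonneg _), ofReal_norm, ← enorm_neg, neg_sub]
    rw [h2]
    apply ENNReal.ofReal_le_ofReal
    linarith [htsum n]
  -- With `y = |1 - h (n + 1)|`, the inequality `y ≤ 2⁻ⁿ + 2ⁿ y²` turns the `4⁻ⁿ` decay of `∫ y²`
  -- into `2⁻ⁿ` decay of `∫ y`. Summability then makes the products `H n` Cauchy, because `|H (n +
  -- 1) - H n| ≤ |1 - h (n + 1)|`.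
  have hsum : ∀ᵐ x ∂m, Summable fun n => ‖1 - (h (n + 1) : C(X, ℂ)) x‖ := by
    have hb : ∀ n, ∫⁻ x, ‖1 - (h (n + 1) : C(X, ℂ)) x‖ₑ ∂m ≤
        ENNReal.ofReal ((1 + 2 * (2 * C + 1) * ε) * (1 / 2) ^ n) := by
      intro n
      have hi : Integrable (fun x => ‖1 - (h (n + 1) : C(X, ℂ)) x‖ ^ 2) m :=
        integrable_continuousMap m
        (⟨fun x => ‖1 - (h (n + 1) : C(X, ℂ)) x‖ ^ 2, by fun_prop⟩ : C(X, ℝ))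
      have hi1 : Integrable (fun x => 1 - (h (n + 1) : C(X, ℂ)) x) m :=
        integrable_continuousMap m (1 - (h (n + 1) : C(X, ℂ)))
      rw [← ofReal_integral_norm_eq_lintegral_enorm hi1]
      apply ENNReal.ofReal_le_ofReal
      have h1 := hrep.integral_norm_one_sub_sq_le (h (n + 1)) (hh1 _) (hht _)
      have h2 := htn n
      have h3 : ∫ x, ‖1 - (h (n + 1) : C(X, ℂ)) x‖ ∂m ≤
          ∫ x, ((1 / 2) ^ n + 2 ^ n * ‖1 - (h (n + 1) : C(X, ℂ)) x‖ ^ 2) ∂m := by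
        refine integral_mono hi1.norm ((integrable_const _).add (hi.const_mul _)) fun x => ?_
        have hp : (0 : ℝ) < 2 ^ n := by positivity
        have hs := sq_nonneg (2 ^ n * ‖1 - (h (n + 1) : C(X, ℂ)) x‖ - 1)
        have hnn := norm_nonneg (1 - (h (n + 1) : C(X, ℂ)) x)
        simp only [one_div, inv_pow]
        generalize ‖1 - (h (n + 1) : C(X, ℂ)) x‖ = y at *
        generalize (2 : ℝ) ^ n = z at *
        have : y * z ≤ (z⁻¹ + z * y ^ 2) * z := by
          rw [add_mul, inv_mul_cancel₀ hp.ne']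
          nlinarith [mul_nonneg hp.le hnn]
        exact le_of_mul_le_mul_right this hp
      rw [integral_add (integrable_const _) (hi.const_mul _), integral_const_mul] at h3
      simp only [integral_const, probReal_univ, one_smul] at h3
      refine h3.trans ?_
      have h4 : (2 : ℝ) ^ n * (1 / 4) ^ n = (1 / 2) ^ n := by
        rw [← mul_pow]; norm_num
      have h5 := mul_le_mul_of_nonneg_left (h1.trans (mul_le_mul_of_nonneg_left h2 zero_le_two))
        (by positivity : (0 : ℝ) ≤ 2 ^ n)
      calc _ ≤ (1 / 2 : ℝ) ^ n + 2 ^ n * (2 * ((2 * C + 1) * ε * (1 / 4) ^ n)) := by gcongr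
        _ = (1 / 2 : ℝ) ^ n + 2 * (2 * C + 1) * ε * (2 ^ n * (1 / 4) ^ n) := by ring
        _ = _ := by rw [h4]; ring
    have hmeas : ∀ n, AEMeasurable (fun x => ‖1 - (h (n + 1) : C(X, ℂ)) x‖ₑ) m := fun n =>
      (integrable_continuousMap m (1 - (h (n + 1) : C(X, ℂ)))).1.enorm
    have hfin : ∫⁻ x, ∑' n, ‖1 - (h (n + 1) : C(X, ℂ)) x‖ₑ ∂m ≠ ∞ := by
      rw [lintegral_tsum hmeas]
      refine ne_top_of_le_ne_top ?_ (ENNReal.tsum_le_tsum hb)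
      have hs : Summable fun n : ℕ => (1 + 2 * (2 * C + 1) * ε) * (1 / 2 : ℝ) ^ n :=
        (summable_geometric_of_lt_one (by norm_num) (by norm_num)).mul_left _
      rw [← ENNReal.ofReal_tsum_of_nonneg (fun n => by positivity) hs]
      exact ENNReal.ofReal_ne_top
    filter_upwards [ae_lt_top' (AEMeasurable.tsum hmeas) hfin] with x hx
    have := ENNReal.summable_toReal hx.ne
    simpa using this
  have hlim : ∀ᵐ x ∂m, ∃ l, Tendsto (fun n => (H n : C(X, ℂ)) x) atTop (𝓝 l) := by
    filter_upwards [hsum] with x hx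
    refine cauchySeq_tendsto_of_complete (cauchySeq_of_summable_dist
      (Summable.of_nonneg_of_le (fun _ => dist_nonneg) (fun n => ?_) hx))
    have h1 : (H (n + 1) : C(X, ℂ)) x = (H n : C(X, ℂ)) x * (h (n + 1) : C(X, ℂ)) x := by
      rw [hHx, hHx, Finset.prod_range_succ _ (n + 1)]
    rw [dist_eq_norm, h1, ← mul_one_sub, norm_mul]
    exact mul_le_of_le_one_left (norm_nonneg _) (hH1 n x)
  obtain ⟨G, hGm, hG⟩ := exists_stronglyMeasurable_limit_of_tendsto_ae
    (fun n => (integrable_continuousMap m (H n : C(X, ℂ))).1) hlim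
  refine ⟨H, G, hGm, hH1, hG, ?_, ?_⟩
  · filter_upwards [hG, hgae] with x hx hgx
    exact le_of_tendsto_of_tendsto' hx.norm
      ((Real.continuous_exp.tendsto _).comp hgx.neg) fun n => hHg n x
  -- Fatou's lemma carries the uniform bound `hHint` to the limit.
  · have h1 : ∀ᵐ x ∂m, ‖G x - 1‖ₑ ^ 2 =
        liminf (fun n => ‖(H n : C(X, ℂ)) x - 1‖ₑ ^ 2) atTop := by
      filter_upwards [hG] with x hx
      refine (Tendsto.liminf_eq ?_).symm
      exact ENNReal.Tendsto.pow (hx.sub_const 1).enorm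
    rw [lintegral_congr_ae h1]
    refine (lintegral_liminf_le' fun n => ?_).trans ?_
    · exact (integrable_continuousMap m ((H n : C(X, ℂ)) - 1)).1.enorm.pow_const 2
    · exact liminf_le_of_le (by isBoundedDefault) fun b hb =>
        let ⟨n, hn⟩ := hb.exists; hn.trans (hHint n)

/-! ### Bounded limits, dominated limits and logarithmic estimates. -/

/-- The functions that are `m`-almost everywhere limits of sequences in the unit ball of `A`. -/
def boundedLimits (A : Subalgebra ℂ C(X, ℂ)) (m : Measure X) : Set (X → ℂ) :=
  {G | StronglyMeasurable G ∧ ∃ H : ℕ → A, (∀ n x, ‖(H n : C(X, ℂ)) x‖ ≤ 1) ∧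
    ∀ᵐ x ∂m, Tendsto (fun n => (H n : C(X, ℂ)) x) atTop (𝓝 (G x))}

/-- `M` is closed under almost everywhere limits of sequences dominated by a function in
`L^q(m)`. -/
def IsClosedUnderDominatedLimits (q : ℝ≥0∞) (m : Measure X) (M : Submodule ℂ (X →ₘ[m] ℂ)) :
    Prop :=
  ∀ (g : ℕ → X →ₘ[m] ℂ) (f : X →ₘ[m] ℂ) (F : X → ℝ), (∀ n, g n ∈ M) → MemLp F q m →
    (∀ n, ∀ᵐ x ∂m, ‖g n x‖ ≤ F x) → (∀ᵐ x ∂m, Tendsto (fun n => g n x) atTop (𝓝 (f x))) → f ∈ M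

/-- Here `r log (1 + x) = log ((1 + x)^r) ≤ (1 + x)^r - 1 ≤ x^r`, by subadditivity of the power `r ≤
1`. -/
theorem log_one_add_le_rpow_div {r x : ℝ} (hr : 0 < r) (hr1 : r ≤ 1) (hx : 0 ≤ x) :
    Real.log (1 + x) ≤ x ^ r / r := by
  have h1 : (1 + x) ^ r ≤ 1 + x ^ r := by
    simpa using Real.rpow_add_le_add_rpow zero_le_one hx hr.le hr1
  have h2 := Real.log_le_sub_one_of_pos (Real.rpow_pos_of_pos (by linarith : 0 < 1 + x) r)
  rw [Real.log_rpow (by linarith)] at h2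
  rw [le_div_iff₀ hr]
  linarith

section Lp

variable {α : Type*} [MeasurableSpace α] {m : Measure α}

/-- Makes `∫ log (1 + |w n|)` tend to 0 when `w n → 0` in `L^p`. Lowering the exponent to `min p 1`
treats all `p` at once. -/
theorem lintegral_log_one_add_norm_le [IsProbabilityMeasure m] {p : ℝ≥0∞} (hp : p ≠ 0)
    {w : α → ℂ} (hw : AEStronglyMeasurable w m) :
    ∫⁻ x, ENNReal.ofReal (Real.log (1 + ‖w x‖)) ∂m ≤
      ENNReal.ofReal (1 / (min p 1).toReal) * eLpNorm w p m ^ (min p 1).toReal := by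
  set r := (min p 1).toReal with hr
  have hs0 : min p 1 ≠ 0 := by simp [hp]
  have hst : min p 1 ≠ ∞ := ne_top_of_le_ne_top ENNReal.one_ne_top (min_le_right _ _)
  have hr0 : 0 < r := ENNReal.toReal_pos hs0 hst
  have hr1 : r ≤ 1 := ENNReal.toReal_mono ENNReal.one_ne_top (min_le_right _ _)
  calc ∫⁻ x, ENNReal.ofReal (Real.log (1 + ‖w x‖)) ∂m
      ≤ ∫⁻ x, ENNReal.ofReal (1 / r) * ‖w x‖ₑ ^ r ∂m := by
        refine lintegral_mono fun x => ?_
        rw [← ofReal_norm, ENNReal.ofReal_rpow_of_nonneg (norm_nonneg _) hr0.le,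
          ← ENNReal.ofReal_mul (by positivity)]
        apply ENNReal.ofReal_le_ofReal
        rw [one_div_mul_eq_div]
        exact log_one_add_le_rpow_div hr0 hr1 (norm_nonneg _)
    _ = ENNReal.ofReal (1 / r) * eLpNorm w (min p 1) m ^ r := by
        rw [lintegral_const_mul' _ _ ENNReal.ofReal_ne_top,
          eLpNorm_eq_lintegral_rpow_enorm_toReal hs0 hst, ← ENNReal.rpow_mul, ← hr,
          one_div_mul_cancel hr0.ne', ENNReal.rpow_one]
    _ ≤ _ := by
        gcongr
        exact eLpNorm_le_eLpNorm_of_exponent_le (min_le_left _ _) hw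

theorem tendsto_eLpNorm_sub_of_dominated {p : ℝ≥0∞} (hp : p ≠ 0) (hp' : p ≠ ∞)
    {g : ℕ → α → ℂ} {f : α → ℂ} {F : α → ℝ} (hg : ∀ n, AEStronglyMeasurable (g n) m)
    (hf : AEStronglyMeasurable f m) (hF : MemLp F p m)
    (hgF : ∀ n, ∀ᵐ x ∂m, ‖g n x‖ ≤ F x)
    (hlim : ∀ᵐ x ∂m, Tendsto (fun n => g n x) atTop (𝓝 (f x))) :
    Tendsto (fun n => eLpNorm (f - g n) p m) atTop (𝓝 0) := by
  have hr0 : 0 < p.toReal := ENNReal.toReal_pos hp hp'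
  have hgF' : ∀ᵐ x ∂m, ∀ n, ‖g n x‖ ≤ F x := ae_all_iff.2 hgF
  have key : Tendsto (fun n => ∫⁻ x, ‖(f - g n) x‖ₑ ^ p.toReal ∂m) atTop (𝓝 (∫⁻ _, 0 ∂m)) := by
    refine tendsto_lintegral_of_dominated_convergence'
      (fun x => ‖(2 : ℝ) • F x‖ₑ ^ p.toReal) (fun n => ((hf.sub (hg n)).enorm.pow_const _))
      (fun n => ?_) ?_ ?_
    · filter_upwards [hgF', hlim] with x hx hl
      have h1 : ‖f x‖ ≤ F x := le_of_tendsto' hl.norm hx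
      gcongr
      rw [enorm_le_iff_norm_le, Pi.sub_apply]
      refine (norm_sub_le _ _).trans ?_
      have := le_abs_self (F x)
      rw [norm_smul, Real.norm_eq_abs, Real.norm_eq_abs, abs_two]
      linarith [hx n]
    · exact (lintegral_rpow_enorm_lt_top_of_eLpNorm_lt_top hp hp' (hF.const_smul (2 : ℝ)).2).ne
    · filter_upwards [hlim] with x hl
      have h1 : Tendsto (fun n => ‖(f - g n) x‖ₑ) atTop (𝓝 0) := by
        have := (tendsto_const_nhds (x := f x)).sub hl
        simpa using this.enorm
      simpa [ENNReal.zero_rpow_of_pos hr0, Function.comp_def] using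
        (ENNReal.continuous_rpow_const (y := p.toReal)).tendsto 0 |>.comp h1
  simp_rw [eLpNorm_eq_lintegral_rpow_enorm_toReal hp hp']
  rw [lintegral_zero] at key
  simpa [ENNReal.zero_rpow_of_pos (inv_pos.2 hr0), Function.comp_def] using
    ((ENNReal.continuous_rpow_const (y := 1 / p.toReal)).tendsto 0).comp key

end Lp

/-- Dominated convergence, in `L^q` for finite `q` and tested against `L¹` for `q = ∞`. Most later
arguments need only this common consequence of the two notions of closedness. -/
theorem IsClosedIn.isClosedUnderDominatedLimits {X : Type*} [MeasurableSpace X]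
    {q : ℝ≥0∞} (hq : q ≠ 0) {m : Measure X}
    [IsFiniteMeasure m]
    {M : Submodule ℂ (X →ₘ[m] ℂ)} (hMq : M ≤ Lp.LpSubmodule ℂ ℂ q m) (hM : IsClosedIn q m M) :
    IsClosedUnderDominatedLimits q m M := by
  intro g f F hgM hF hgF hlim
  have hgF' : ∀ᵐ x ∂m, ∀ n, ‖g n x‖ ≤ F x := ae_all_iff.2 hgF
  have hfF : ∀ᵐ x ∂m, ‖f x‖ ≤ F x := by
    filter_upwards [hgF', hlim] with x hx hl
    exact le_of_tendsto' hl.norm hx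
  have hfq : MemLp f q m := hF.mono' f.aestronglyMeasurable hfF
  rcases eq_or_ne q ∞ with rfl | hq'
  · let g' : ℕ → Lp ℂ ∞ m := fun n => ⟨g n, hMq (hgM n)⟩
    let f' : Lp ℂ ∞ m := ⟨f, Lp.mem_Lp_iff_memLp.2 hfq⟩
    have hcl := hM.1 rfl
    have ht : @Tendsto _ _ g' atTop (@nhds _ (weakStarTopology m) f') := by
      rw [nhds_induced, tendsto_comap_iff, tendsto_pi_nhds]
      intro k
      have hb : ∀ᵐ x ∂m, F x ≤ (eLpNormEssSup F m).toReal := by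
        have htop : eLpNormEssSup F m ≠ ∞ := by simpa using hF.2.ne
        filter_upwards [ae_le_eLpNormEssSup (f := F) (μ := m)] with x hx
        have := ENNReal.toReal_mono htop hx
        exact (le_abs_self _).trans (by simpa using this)
      refine tendsto_integral_of_dominated_convergence
        (fun x => (eLpNormEssSup F m).toReal * ‖k x‖)
        (fun n => (g n).aestronglyMeasurable.mul (Lp.aestronglyMeasurable k))
        ((L1.integrable_coeFn k).norm.const_mul _) (fun n => ?_) ?_
      · filter_upwards [hgF n, hb] with x h1 h2
        rw [norm_mul]
        gcongr
        exact h1.trans h2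
      · filter_upwards [hlim] with x hx
        exact hx.mul_const _
    have hmem := @IsClosed.mem_of_tendsto _ (weakStarTopology m) _ _ _ _ _ _ hcl ht
      (Eventually.of_forall hgM)
    exact hmem
  · refine hM.2 hq' ⟨Lp.mem_Lp_iff_memLp.2 hfq, fun ε hε => ?_⟩
    have h1 := tendsto_eLpNorm_sub_of_dominated hq hq' (fun n => (g n).aestronglyMeasurable)
      f.aestronglyMeasurable hF hgF hlim
    obtain ⟨n, hn⟩ := (h1.eventually_lt_const hε).exists
    exact ⟨g n, hgM n, by rwa [eLpNorm_congr_ae (AEEqFun.coeFn_sub f (g n))]⟩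

/-- A subspace of `L^q(m)` that is invariant under `A` is invariant under bounded limits of
functions in `A`. -/
theorem IsClosedUnderDominatedLimits.mk_mul_mem
    {X : Type*} [TopologicalSpace X] [MeasurableSpace X] [BorelSpace X]
    {q : ℝ≥0∞} {m : Measure X}
    {A : Subalgebra ℂ C(X, ℂ)} {M : Submodule ℂ (X →ₘ[m] ℂ)}
    (hM : IsClosedUnderDominatedLimits q m M) (hMq : M ≤ Lp.LpSubmodule ℂ ℂ q m)
    (hinv : ∀ a ∈ A, ∀ f ∈ M, ContinuousMap.toAEEqFun m a * f ∈ M) {G : X → ℂ}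
    (hG : G ∈ boundedLimits A m) (hGm : AEStronglyMeasurable G m) {f : X →ₘ[m] ℂ} (hf : f ∈ M) :
    AEEqFun.mk G hGm * f ∈ M := by
  obtain ⟨-, H, hH1, hH⟩ := hG
  have hco : ∀ n, ∀ᵐ x ∂m, (ContinuousMap.toAEEqFun m (H n : C(X, ℂ)) * f) x
      = (H n : C(X, ℂ)) x * f x := fun n => by
    filter_upwards [AEEqFun.coeFn_mul (ContinuousMap.toAEEqFun m (H n : C(X, ℂ))) f,
      ContinuousMap.coeFn_toAEEqFun m (H n : C(X, ℂ))] with x h1 h2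
    rw [h1, Pi.mul_apply, h2]
  refine hM (fun n => ContinuousMap.toAEEqFun m (H n : C(X, ℂ)) * f) _ (fun x => ‖f x‖)
    (fun n => hinv _ (H n).2 f hf) (Lp.mem_Lp_iff_memLp.1 (hMq hf)).norm (fun n => ?_) ?_
  · filter_upwards [hco n] with x hx
    rw [hx, norm_mul]
    exact mul_le_of_le_one_left (norm_nonneg _) (hH1 n x)
  · filter_upwards [ae_all_iff.2 hco, hH, AEEqFun.coeFn_mk G hGm,
      AEEqFun.coeFn_mul (AEEqFun.mk G hGm) f] with x h1 h2 h3 h4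
    simp_rw [h1]
    rw [h4, Pi.mul_apply, h3]
    exact h2.mul_const _

/-- If `w n → 0` in `L^p(m)`, then along a subsequence there are bounded limits of functions in
`A` that tend to `1` almost everywhere and are dominated by `1 / (1 + |w n|)`. -/
theorem IsCoreMeasure.exists_boundedLimits_tendsto_one [T2Space X] {A : Subalgebra ℂ C(X, ℂ)}
    (hA : IsUniformAlgebra A) {φ : A →ₐ[ℂ] ℂ}
    (hφ : FiniteDimensional ℝ (vectorSpan ℝ (representingMeasures φ)))
    {m : Measure X} [IsFiniteMeasure m] (hm : IsCoreMeasure φ m) {p : ℝ≥0∞} (hp : p ≠ 0)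
    {w : ℕ → X → ℂ} (hwm : ∀ n, AEStronglyMeasurable (w n) m) (hw' : ∀ n, eLpNorm (w n) p m ≠ ∞)
    (hw : Tendsto (fun n => eLpNorm (w n) p m) atTop (𝓝 0)) :
    ∃ (ns : ℕ → ℕ) (G : ℕ → X → ℂ), StrictMono ns ∧ (∀ n, G n ∈ boundedLimits A m) ∧
      (∀ n, ∀ᵐ x ∂m, ‖G n x‖ ≤ (1 + ‖w (ns n) x‖)⁻¹) ∧
      (∀ᵐ x ∂m, Tendsto (fun n => G n x) atTop (𝓝 1)) := by
  have := hm.isRepresentingMeasure.isProbabilityMeasure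
  obtain ⟨K, hK0, hK⟩ := hm.exists_limit_norm_le_exp hA hφ
  set r := (min p 1).toReal with hr
  have hr0 : 0 < r := ENNReal.toReal_pos (by simp [hp])
    (ne_top_of_le_ne_top ENNReal.one_ne_top (min_le_right _ _))
  have hle := fun n => lintegral_log_one_add_norm_le hp (hwm n)
  -- Chosen so that `exp (-u n) = 1 / (1 + |w n|)`.
  let u : ℕ → X → ℝ := fun n x => Real.log (1 + ‖w n x‖)
  have hu0 : ∀ n, 0 ≤ u n := fun n x => Real.log_nonneg (by linarith [norm_nonneg (w n x)])
  have hum : ∀ n, AEStronglyMeasurable (u n) m := fun n =>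
    (Real.measurable_log.comp_aemeasurable
      ((hwm n).norm.aemeasurable.const_add 1)).aestronglyMeasurable
  have hfin : ∀ n, ENNReal.ofReal (1 / r) * eLpNorm (w n) p m ^ r ≠ ∞ := fun n =>
    ENNReal.mul_ne_top ENNReal.ofReal_ne_top (ENNReal.rpow_ne_top_of_nonneg hr0.le (hw' n))
  have hui : ∀ n, Integrable (u n) m := fun n => by
    refine ⟨hum n, ?_⟩
    rw [hasFiniteIntegral_iff_ofReal (Eventually.of_forall (hu0 n))]
    exact (hle n).trans_lt (hfin n).lt_top
  have hlim : Tendsto (fun n => ∫ x, u n x ∂m) atTop (𝓝 0) := by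
    have h1 : Tendsto (fun n => ENNReal.ofReal (1 / r) * eLpNorm (w n) p m ^ r) atTop (𝓝 0) := by
      have h2 := ((ENNReal.continuous_rpow_const (y := r)).tendsto 0).comp hw
      rw [ENNReal.zero_rpow_of_pos hr0] at h2
      simpa using ENNReal.Tendsto.const_mul h2 (Or.inr ENNReal.ofReal_ne_top)
    have h2 := tendsto_of_tendsto_of_tendsto_of_le_of_le tendsto_const_nhds h1
      (fun n => zero_le) hle
    have h3 : ∀ n, ∫ x, u n x ∂m = (∫⁻ x, ENNReal.ofReal (Real.log (1 + ‖w n x‖)) ∂m).toReal :=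
      fun n => integral_eq_lintegral_of_nonneg_ae (Eventually.of_forall (hu0 n)) (hum n)
    simp_rw [h3]
    exact (ENNReal.tendsto_toReal ENNReal.zero_ne_top).comp h2
  choose H G hGm hH1 hHG hGu hGint using fun n : ℕ =>
    hK (u n) (hu0 n) (hui n) (1 / ((n : ℝ) + 1)) (by positivity)
  have hb : Tendsto (fun n : ℕ => ENNReal.ofReal (K * (∫ x, u n x ∂m + 1 / ((n : ℝ) + 1)))) atTop
      (𝓝 0) := by
    have h1 := (hlim.add tendsto_one_div_add_atTop_nhds_zero_nat).const_mul K
    simpa using ENNReal.tendsto_ofReal h1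
  have hint := tendsto_of_tendsto_of_tendsto_of_le_of_le tendsto_const_nhds hb
      (fun n => zero_le) hGint
  have hL2 : Tendsto (fun n => eLpNorm (G n - fun _ => (1 : ℂ)) 2 m) atTop (𝓝 0) := by
    have h1 : ∀ n, eLpNorm (G n - fun _ => (1 : ℂ)) 2 m
        = (∫⁻ x, ‖G n x - 1‖ₑ ^ 2 ∂m) ^ (1 / 2 : ℝ) := fun n => by
      rw [eLpNorm_eq_lintegral_rpow_enorm_toReal two_ne_zero ENNReal.ofNat_ne_top]
      simp
    simp_rw [h1]
    have h2 := ((ENNReal.continuous_rpow_const (y := (1 / 2 : ℝ))).tendsto 0).comp hint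
    rwa [ENNReal.zero_rpow_of_pos (by norm_num)] at h2
  obtain ⟨ns, hns, hae⟩ := (tendstoInMeasure_of_tendsto_eLpNorm two_ne_zero
    (fun n => (hGm n).aestronglyMeasurable) aestronglyMeasurable_const hL2).exists_seq_tendsto_ae
  refine ⟨ns, fun n => G (ns n), hns, fun n => ⟨hGm _, H (ns n), hH1 _, hHG _⟩, fun n => ?_, hae⟩
  filter_upwards [hGu (ns n)] with x hx
  have hpos : 0 < 1 + ‖w (ns n) x‖ := by positivity
  rwa [← Real.log_inv, Real.exp_log (inv_pos.2 hpos)] at hx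

/-! ### Closures in `L^p`, including the quasi-normed range `p < 1`. -/

section Closure

variable {α : Type*} [MeasurableSpace α] {m : Measure α} {p q : ℝ≥0∞}
  {S T : Set (α →ₘ[m] ℂ)}

theorem mem_lpClosure_iff_exists_seq {f : α →ₘ[m] ℂ} :
    f ∈ lpClosure p m S ↔ f ∈ Lp ℂ p m ∧ ∃ g : ℕ → α →ₘ[m] ℂ, (∀ n, g n ∈ S) ∧
      Tendsto (fun n => eLpNorm (f - g n : α →ₘ[m] ℂ) p m) atTop (𝓝 0) := by
  refine and_congr_right fun _ => ⟨fun h => ?_, ?_⟩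
  · obtain ⟨c, -, hc0, hc⟩ := exists_seq_strictAnti_tendsto' (zero_lt_one (α := ℝ≥0∞))
    choose g hgS hg using fun n => h (c n) (hc0 n).1
    exact ⟨g, hgS, tendsto_of_tendsto_of_tendsto_of_le_of_le tendsto_const_nhds hc
      (fun _ => zero_le) fun n => (hg n).le⟩
  · rintro ⟨g, hgS, hg⟩ ε hε
    obtain ⟨n, hn⟩ := (hg.eventually_lt_const hε).exists
    exact ⟨g n, hgS n, hn⟩

theorem eLpNorm_aeeqFun_add_le (f g : α →ₘ[m] ℂ) :
    eLpNorm (f + g : α →ₘ[m] ℂ) p m ≤ p.LpAddConst * (eLpNorm f p m + eLpNorm g p m) := by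
  rw [eLpNorm_congr_ae (AEEqFun.coeFn_add f g)]
  exact eLpNorm_add_le' f.aestronglyMeasurable g.aestronglyMeasurable p

theorem tendsto_eLpNorm_add_zero {f g : ℕ → α →ₘ[m] ℂ}
    (hf : Tendsto (fun n => eLpNorm (f n) p m) atTop (𝓝 0))
    (hg : Tendsto (fun n => eLpNorm (g n) p m) atTop (𝓝 0)) :
    Tendsto (fun n => eLpNorm (f n + g n : α →ₘ[m] ℂ) p m) atTop (𝓝 0) := by
  have h := ENNReal.Tendsto.const_mul (hf.add hg) (Or.inr (ENNReal.LpAddConst_lt_top p).ne)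
  rw [add_zero, mul_zero] at h
  exact tendsto_of_tendsto_of_tendsto_of_le_of_le tendsto_const_nhds h (fun _ => zero_le)
    fun n => eLpNorm_aeeqFun_add_le _ _

theorem subset_lpClosure (hS : S ⊆ Lp ℂ p m) : S ⊆ lpClosure p m S := fun f hf =>
  ⟨hS hf, fun ε hε => ⟨f, hf, by
    rw [sub_self, eLpNorm_congr_ae AEEqFun.coeFn_zero, eLpNorm_zero]; exact hε⟩⟩

theorem lpClosure_mono (h : S ⊆ T) : lpClosure p m S ⊆ lpClosure p m T := fun _ hf =>
  ⟨hf.1, fun ε hε => let ⟨g, hg, hgε⟩ := hf.2 ε hε; ⟨g, h hg, hgε⟩⟩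

theorem lpClosure_lpClosure_subset : lpClosure p m (lpClosure p m S) ⊆ lpClosure p m S := by
  intro f hf
  obtain ⟨hfp, g, hg, hlim⟩ := mem_lpClosure_iff_exists_seq.1 hf
  obtain ⟨c, -, hc0, hc⟩ := exists_seq_strictAnti_tendsto' (zero_lt_one (α := ℝ≥0∞))
  choose k hkS hk using fun n => (hg n).2 (c n) (hc0 n).1
  refine mem_lpClosure_iff_exists_seq.2 ⟨hfp, k, hkS, ?_⟩
  have h2 := tendsto_of_tendsto_of_tendsto_of_le_of_le tendsto_const_nhds hc
      (fun _ => zero_le) fun n => (hk n).le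
  simpa using tendsto_eLpNorm_add_zero hlim h2

theorem lpClosure_subset_of_exponent_le [IsProbabilityMeasure m] (hpq : p ≤ q) :
    lpClosure q m S ⊆ lpClosure p m S := fun _ hf =>
  ⟨Lp.antitone hpq hf.1, fun ε hε => let ⟨g, hg, hgε⟩ := hf.2 ε hε
    ⟨g, hg, (eLpNorm_le_eLpNorm_of_exponent_le hpq (AEEqFun.aestronglyMeasurable _)).trans_lt hgε⟩⟩

/-- The closure in `L^p(m)` of a subspace, as a subspace. -/
def lpClosureSubmodule (p : ℝ≥0∞) (m : Measure α) (M : Submodule ℂ (α →ₘ[m] ℂ)) :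
    Submodule ℂ (α →ₘ[m] ℂ) where
  carrier := lpClosure p m M
  zero_mem' := ⟨zero_mem _, fun ε hε => ⟨0, zero_mem _, by
    rw [sub_self, eLpNorm_congr_ae AEEqFun.coeFn_zero, eLpNorm_zero]; exact hε⟩⟩
  add_mem' := by
    intro f f' hf hf'
    obtain ⟨hfp, g, hg, hlim⟩ := mem_lpClosure_iff_exists_seq.1 hf
    obtain ⟨hfp', g', hg', hlim'⟩ := mem_lpClosure_iff_exists_seq.1 hf'
    refine mem_lpClosure_iff_exists_seq.2 ⟨add_mem hfp hfp', fun n => g n + g' n,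
      fun n => add_mem (hg n) (hg' n), ?_⟩
    simpa only [add_sub_add_comm] using tendsto_eLpNorm_add_zero hlim hlim'
  smul_mem' := by
    intro c f hf
    obtain ⟨hfp, g, hg, hlim⟩ := mem_lpClosure_iff_exists_seq.1 hf
    refine mem_lpClosure_iff_exists_seq.2 ⟨(Lp.LpSubmodule ℂ ℂ p m).smul_mem c hfp,
      fun n => c • g n, fun n => M.smul_mem c (hg n), ?_⟩
    have h := ENNReal.Tendsto.const_mul hlim (Or.inr (enorm_ne_top (x := c)))
    rw [mul_zero] at h
    refine h.congr fun n => ?_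
    rw [← smul_sub, eLpNorm_congr_ae (AEEqFun.coeFn_smul c (f - g n)), eLpNorm_const_smul]

end Closure

/-! ### The two multiplier arguments. -/

/-- From `‖b‖ ≤ ‖a‖ + ‖a - b‖ ≤ (1 + ‖a‖) (1 + ‖a - b‖)`. With `a = f x` and `b = g n x` it gives a
majorant of `G n * g n` independent of `n`. -/
theorem inv_one_add_norm_sub_mul_norm_le {E : Type*} [SeminormedAddCommGroup E] (a b : E) :
    (1 + ‖a - b‖)⁻¹ * ‖b‖ ≤ 1 + ‖a‖ := by
  rw [inv_mul_le_iff₀ (by positivity)]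
  have h := norm_sub_norm_le b a
  rw [norm_sub_rev] at h
  nlinarith [norm_nonneg a, norm_nonneg (a - b), mul_nonneg (norm_nonneg a) (norm_nonneg (a - b))]

/-- A function in `L^q(m)` that is an `L^p(m)` limit of elements of an invariant subspace of
`L^q(m)` closed under dominated limits belongs to that subspace. -/
theorem IsCoreMeasure.mem_of_mem_lpClosure [T2Space X] {A : Subalgebra ℂ C(X, ℂ)}
    (hA : IsUniformAlgebra A) {φ : A →ₐ[ℂ] ℂ}
    (hφ : FiniteDimensional ℝ (vectorSpan ℝ (representingMeasures φ)))
    {m : Measure X} [IsFiniteMeasure m] (hm : IsCoreMeasure φ m) {p q : ℝ≥0∞} (hp : p ≠ 0)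
    {M : Submodule ℂ (X →ₘ[m] ℂ)} (hM : IsClosedUnderDominatedLimits q m M)
    (hMq : M ≤ Lp.LpSubmodule ℂ ℂ q m)
    (hinv : ∀ a ∈ A, ∀ f ∈ M, ContinuousMap.toAEEqFun m a * f ∈ M) 
    (hMp : M ≤ Lp.LpSubmodule ℂ ℂ p m)
    {f : X →ₘ[m] ℂ} (hfq : f ∈ Lp ℂ q m) (hf : f ∈ lpClosure p m M) : f ∈ M := by
  obtain ⟨hfp, g, hg, hlim⟩ := mem_lpClosure_iff_exists_seq.1 hf
  have hgp : ∀ n, g n ∈ Lp ℂ p m := fun n => hMp (hg n)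
  have hfg : ∀ n, eLpNorm (f - g n : X →ₘ[m] ℂ) p m ≠ ∞ := fun n =>
    (Lp.mem_Lp_iff_eLpNorm_lt_top.1 ((Lp ℂ p m).sub_mem hfp (hgp n))).ne
  have hF : MemLp (fun x => 1 + ‖f x‖) q m :=
    (memLp_const (1 : ℝ)).add (Lp.mem_Lp_iff_memLp.1 hfq).norm
  obtain ⟨ns, G, hns, hG, hGw, hG1⟩ := hm.exists_boundedLimits_tendsto_one hA hφ hp
    (w := fun n => (f - g n : X →ₘ[m] ℂ)) (fun n => AEEqFun.aestronglyMeasurable _) hfg hlim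
  have hsub : ∀ n, ∀ᵐ x ∂m, (f - g n : X →ₘ[m] ℂ) x = f x - g n x := fun n =>
    AEEqFun.coeFn_sub f (g n)
  -- A second subsequence `ks` is needed: `ns` gives `G n → 1` a.e., but `g (ns n) → f` so far only
  -- in `L^p`.
  have hgm : TendstoInMeasure m (fun n => (g (ns n) : X → ℂ)) atTop f := by
    refine tendstoInMeasure_of_tendsto_eLpNorm hp (fun n => (g (ns n)).aestronglyMeasurable)
      f.aestronglyMeasurable ?_
    refine (hlim.comp hns.tendsto_atTop).congr fun n => ?_
    rw [Function.comp_apply, eLpNorm_congr_ae (AEEqFun.coeFn_sub f (g (ns n))), eLpNorm_sub_comm]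
  obtain ⟨ks, hks, hae⟩ := hgm.exists_seq_tendsto_ae
  have hGm : ∀ n, AEStronglyMeasurable (G n) m := fun n => (hG n).1.aestronglyMeasurable
  have hmul : ∀ n, ∀ᵐ x ∂m, (AEEqFun.mk (G n) (hGm n) * g (ns n)) x
      = G n x * g (ns n) x := fun n => by
    filter_upwards [AEEqFun.coeFn_mul (AEEqFun.mk (G n) (hGm n)) (g (ns n)),
      AEEqFun.coeFn_mk (G n) (hGm n)] with x h1 h2
    rw [h1, Pi.mul_apply, h2]
  refine hM (fun n => AEEqFun.mk (G (ks n)) (hGm (ks n)) * g (ns (ks n))) f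
    (fun x => 1 + ‖f x‖) (fun n => hM.mk_mul_mem hMq hinv (hG _) (hGm _) (hg _))
    hF (fun n => ?_) ?_
  · filter_upwards [hmul (ks n), hGw (ks n), hsub (ns (ks n))] with x h1 h2 h3
    rw [h3] at h2
    rw [h1, norm_mul]
    calc ‖G (ks n) x‖ * ‖g (ns (ks n)) x‖
        ≤ (1 + ‖f x - g (ns (ks n)) x‖)⁻¹ * ‖g (ns (ks n)) x‖ := by gcongr
      _ ≤ 1 + ‖f x‖ := inv_one_add_norm_sub_mul_norm_le _ _
  · filter_upwards [ae_all_iff.2 hmul, hG1, hae] with x h1 h2 h3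
    simp_rw [h1]
    simpa using (h2.comp hks.tendsto_atTop).mul h3

/-- In a closed invariant subspace of `L^p(m)`, `p < ∞`, the bounded functions are dense. -/
theorem IsCoreMeasure.subset_lpClosure_inf_Lp [T2Space X] {A : Subalgebra ℂ C(X, ℂ)}
    (hA : IsUniformAlgebra A) {φ : A →ₐ[ℂ] ℂ}
    (hφ : FiniteDimensional ℝ (vectorSpan ℝ (representingMeasures φ)))
    {m : Measure X} [IsFiniteMeasure m] (hm : IsCoreMeasure φ m) {p : ℝ≥0∞} (hp : p ≠ 0)
    (hp' : p ≠ ∞) (q : ℝ≥0∞)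
    {M : Submodule ℂ (X →ₘ[m] ℂ)} (hM : IsClosedUnderDominatedLimits p m M)
    (hMp : M ≤ Lp.LpSubmodule ℂ ℂ p m)
    (hinv : ∀ a ∈ A, ∀ f ∈ M, ContinuousMap.toAEEqFun m a * f ∈ M) :
    (M : Set (X →ₘ[m] ℂ)) ⊆
      lpClosure p m ((M ⊓ Lp.LpSubmodule ℂ ℂ q m : Submodule ℂ (X →ₘ[m] ℂ)) : Set _) := by
  intro f hf
  have hfp : MemLp f p m := Lp.mem_Lp_iff_memLp.1 (hMp hf)
  have hnorm : ∀ n : ℕ, eLpNorm ((((n : ℝ) + 1)⁻¹ : ℝ) • (f : X → ℂ)) p m =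
      ENNReal.ofReal (1 / ((n : ℝ) + 1)) * eLpNorm f p m := fun n => by
    rw [eLpNorm_const_smul, one_div, Real.enorm_eq_ofReal (by positivity)]
  obtain ⟨ns, G, hns, hG, hGw, hG1⟩ := hm.exists_boundedLimits_tendsto_one hA hφ hp
    (w := fun n => (((n : ℝ) + 1)⁻¹ : ℝ) • (f : X → ℂ))
    (fun n => f.aestronglyMeasurable.const_smul _)
    (fun n => (hfp.const_smul (((n : ℝ) + 1)⁻¹ : ℝ)).2.ne) (by
      simp_rw [hnorm]
      have h1 := ENNReal.tendsto_ofReal (tendsto_one_div_add_atTop_nhds_zero_nat (𝕜 := ℝ))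
      have h2 := ENNReal.Tendsto.mul_const h1 (Or.inr hfp.2.ne)
      simpa using h2)
  have hGm : ∀ n, AEStronglyMeasurable (G n) m := fun n => (hG n).1.aestronglyMeasurable
  have hmul : ∀ n, ∀ᵐ x ∂m, (AEEqFun.mk (G n) (hGm n) * f : X →ₘ[m] ℂ) x
      = G n x * f x := fun n => by
    filter_upwards [AEEqFun.coeFn_mul (AEEqFun.mk (G n) (hGm n)) f,
      AEEqFun.coeFn_mk (G n) (hGm n)] with x h1 h2
    rw [h1, Pi.mul_apply, h2]
  refine mem_lpClosure_iff_exists_seq.2 ⟨hMp hf,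
    fun n => AEEqFun.mk (G n) (hGm n) * f,
    fun n => ⟨hM.mk_mul_mem hMp hinv (hG n) (hGm n) hf, ?_⟩, ?_⟩
  · refine Lp.mem_Lp_iff_memLp.2 (MemLp.of_bound (AEEqFun.aestronglyMeasurable _)
      ((ns n : ℝ) + 1) ?_)
    filter_upwards [hmul n, hGw n] with x h1 h2
    rw [h1, norm_mul]
    have hn : 0 < (ns n : ℝ) + 1 := by positivity
    rw [Pi.smul_apply, norm_smul, Real.norm_eq_abs, abs_of_pos (inv_pos.2 hn)] at h2
    have hpos : 0 < 1 + ((ns n : ℝ) + 1)⁻¹ * ‖f x‖ := by positivity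
    -- With `N = ns n + 1` and `y = ‖f x‖`, `y / (1 + y / N) ≤ N`.
    calc ‖G n x‖ * ‖f x‖ ≤ (1 + ((ns n : ℝ) + 1)⁻¹ * ‖f x‖)⁻¹ * ‖f x‖ := by gcongr
      _ ≤ (ns n : ℝ) + 1 := by
        rw [inv_mul_le_iff₀ hpos, add_mul, one_mul, mul_right_comm, inv_mul_cancel₀ hn.ne',
          one_mul]
        linarith
  · have h1 := tendsto_eLpNorm_sub_of_dominated (m := m) hp hp'
      (g := fun n => (AEEqFun.mk (G n) (hGm n) * f : X →ₘ[m] ℂ))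
      (f := f) (F := fun x => ‖f x‖)
      (fun n => AEEqFun.aestronglyMeasurable _) f.aestronglyMeasurable hfp.norm (fun n => ?_) ?_
    · refine h1.congr fun n => ?_
      rw [eLpNorm_congr_ae (AEEqFun.coeFn_sub _ _)]
    · filter_upwards [hmul n, hGw n] with x h1 h2
      rw [h1, norm_mul]
      refine mul_le_of_le_one_left (norm_nonneg _) (h2.trans (inv_le_one_of_one_le₀ ?_))
      linarith [norm_nonneg (((((ns n : ℝ) + 1)⁻¹ : ℝ) • (f : X → ℂ)) x)]
    · filter_upwards [ae_all_iff.2 hmul, hG1] with x h1 h2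
      simp_rw [h1]
      simpa using h2.mul_const (f x)

/-! ### Weak-star closures and permanence of closed invariant subspaces. -/

/-- A function in the weak-star closure of a subspace of `L^∞(m)` is in its closure in `L²(m)`. -/
theorem mem_lpClosure_two_of_mem_closure_weakStar {X : Type*} [MeasurableSpace X]
    {m : Measure X} [IsProbabilityMeasure m]
    {M : Submodule ℂ (X →ₘ[m] ℂ)} {f : Lp ℂ ∞ m}
    (hf : f ∈ @closure _ (weakStarTopology m) {f : Lp ℂ ∞ m | (f : X →ₘ[m] ℂ) ∈ M}) :
    (f : X →ₘ[m] ℂ) ∈ lpClosure 2 m (M : Set (X →ₘ[m] ℂ)) := by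
  have h2 : ∀ {g : X →ₘ[m] ℂ}, g ∈ Lp ℂ ∞ m → g ∈ Lp ℂ 2 m := fun h => Lp.antitone le_top h
  let S : Submodule ℂ (Lp ℂ 2 m) :=
    { carrier := {g | (g : X →ₘ[m] ℂ) ∈ M}
      zero_mem' := M.zero_mem
      add_mem' := fun ha hb => M.add_mem ha hb
      smul_mem' := fun c _ ha => M.smul_mem c ha }
  let f2 : Lp ℂ 2 m := ⟨f, h2 f.2⟩
  have hf2 : f2 ∈ S.topologicalClosure := by
    -- For `k` orthogonal to `S` in `L²`, `star k` lies in `L¹`, so `g ↦ ∫ g * star k` is weak-star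
    -- continuous; it vanishes on `M ∩ L^∞`, hence at `f`.
    rw [← Submodule.orthogonal_orthogonal_eq_closure, Submodule.mem_orthogonal]
    intro k hk
    have hk1 : MemLp (fun x => star (k x)) 1 m := ((Lp.memLp k).star).mono_exponent one_le_two
    let k1 : Lp ℂ 1 m := hk1.toLp _
    have hinner : ∀ (g : Lp ℂ ∞ m), ∫ x, g x * k1 x ∂m =
        inner ℂ k (⟨g, h2 g.2⟩ : Lp ℂ 2 m) := fun g => by
      rw [L2.inner_def]
      refine integral_congr_ae ?_
      filter_upwards [hk1.coeFn_toLp] with x hx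
      change g x * k1 x = inner ℂ (k x) (g x)
      rw [show k1 x = star (k x) from hx]
      simp [inner]
    have hcont : @Continuous _ _ (weakStarTopology m) _
        (fun g : Lp ℂ ∞ m => ∫ x, g x * k1 x ∂m) := by
      have h1 := @continuous_induced_dom (Lp ℂ ∞ m) (Lp ℂ 1 m → ℂ)
        (fun f (g : Lp ℂ 1 m) => ∫ x, f x * g x ∂m) Pi.topologicalSpace
      exact @Continuous.comp (Lp ℂ ∞ m) (Lp ℂ 1 m → ℂ) ℂ (weakStarTopology m) _ _ _
        (fun F => F k1) (continuous_apply k1) h1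
    have hcl := @IsClosed.preimage _ _ (weakStarTopology m) _ _ hcont {0} isClosed_singleton
    have hsub : {g : Lp ℂ ∞ m | (g : X →ₘ[m] ℂ) ∈ M} ⊆
        (fun g : Lp ℂ ∞ m => ∫ x, g x * k1 x ∂m) ⁻¹' {0} := fun g hg => by
      change ∫ x, g x * k1 x ∂m = 0
      rw [hinner]
      exact (Submodule.mem_orthogonal' S k).1 hk ⟨g, h2 g.2⟩ hg
    have hmem : ∫ x, f x * k1 x ∂m = 0 := @closure_minimal _ (weakStarTopology m) _ _ hsub hcl f hf
    rw [hinner] at hmem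
    exact hmem
  refine ⟨h2 f.2, fun ε hε => ?_⟩
  obtain ⟨g, hg, hgε⟩ := EMetric.mem_closure_iff.1
    (show f2 ∈ closure (S : Set (Lp ℂ 2 m)) from hf2) ε hε
  refine ⟨g, hg, ?_⟩
  rw [Lp.edist_def] at hgε
  rwa [eLpNorm_congr_ae (AEEqFun.coeFn_sub _ _)]

theorem eLpNorm_toAEEqFun_mul_le (m : Measure X) {p : ℝ≥0∞}
    (a : C(X, ℂ)) (f : X →ₘ[m] ℂ) :
    eLpNorm (ContinuousMap.toAEEqFun m a * f : X →ₘ[m] ℂ) p m ≤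
      ENNReal.ofReal ‖a‖ * eLpNorm f p m := by
  refine eLpNorm_le_mul_eLpNorm_of_ae_le_mul ?_ p
  filter_upwards [AEEqFun.coeFn_mul (ContinuousMap.toAEEqFun m a) f,
    ContinuousMap.coeFn_toAEEqFun m a] with x h1 h2
  rw [h1, Pi.mul_apply, h2, norm_mul]
  gcongr
  exact a.norm_coe_le_norm x

theorem aeeqFun_mul_sub {α : Type*} [MeasurableSpace α] {m : Measure α} (a f g : α →ₘ[m] ℂ) :
    a * (f - g) = a * f - a * g := by
  refine AEEqFun.induction_on₃ a f g fun a ha f hf g hg => ?_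
  rw [← AEEqFun.mk_sub f g hf hg, AEEqFun.mk_mul_mk, AEEqFun.mk_mul_mk, AEEqFun.mk_mul_mk,
    ← AEEqFun.mk_sub _ _ (ha.mul hf) (ha.mul hg), AEEqFun.mk_eq_mk, mul_sub]

theorem lpClosureSubmodule_mem_closedInvariantSubspaces {A : Subalgebra ℂ C(X, ℂ)}
    {m : Measure X} [IsFiniteMeasure m] {p : ℝ≥0∞} (hp' : p ≠ ∞) {M : Submodule ℂ (X →ₘ[m] ℂ)}
    (hinv : ∀ a ∈ A, ∀ f ∈ M, ContinuousMap.toAEEqFun m a * f ∈ M) :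
    lpClosureSubmodule p m M ∈ closedInvariantSubspaces A p m := by
  refine ⟨fun f hf => hf.1, ⟨fun h => absurd h hp', fun _ => lpClosure_lpClosure_subset⟩,
    fun a ha f hf => ?_⟩
  obtain ⟨hfp, g, hg, hlim⟩ := mem_lpClosure_iff_exists_seq.1 hf
  refine mem_lpClosure_iff_exists_seq.2 ⟨?_, fun n => ContinuousMap.toAEEqFun m a * g n,
    fun n => hinv a ha _ (hg n), ?_⟩
  · rw [Lp.mem_Lp_iff_eLpNorm_lt_top] at hfp ⊢
    exact (eLpNorm_toAEEqFun_mul_le m a f).trans_lt (ENNReal.mul_lt_top ENNReal.ofReal_lt_top hfp)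
  · have h := ENNReal.Tendsto.const_mul hlim (Or.inr (ENNReal.ofReal_ne_top (r := ‖a‖)))
    rw [mul_zero] at h
    refine tendsto_of_tendsto_of_tendsto_of_le_of_le tendsto_const_nhds h (fun _ => zero_le)
      fun n => ?_
    rw [← aeeqFun_mul_sub]
    exact eLpNorm_toAEEqFun_mul_le m a (f - g n)

theorem IsCoreMeasure.inf_Lp_mem_closedInvariantSubspaces [T2Space X] {A : Subalgebra ℂ C(X, ℂ)}
    (hA : IsUniformAlgebra A) {φ : A →ₐ[ℂ] ℂ}
    (hφ : FiniteDimensional ℝ (vectorSpan ℝ (representingMeasures φ)))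
    {m : Measure X} [IsFiniteMeasure m] (hm : IsCoreMeasure φ m) {p q : ℝ≥0∞} (hp : p ≠ 0)
    (hpq : p < q) {M : Submodule ℂ (X →ₘ[m] ℂ)} (hM : M ∈ closedInvariantSubspaces A p m) :
    M ⊓ Lp.LpSubmodule ℂ ℂ q m ∈ closedInvariantSubspaces A q m := by
  have := hm.isRepresentingMeasure.isProbabilityMeasure
  obtain ⟨hMp, hMcl, hMinv⟩ := hM
  have hinv : ∀ a ∈ A, ∀ f ∈ M ⊓ Lp.LpSubmodule ℂ ℂ q m,
      ContinuousMap.toAEEqFun m a * f ∈ M ⊓ Lp.LpSubmodule ℂ ℂ q m := fun a ha f hf =>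
    ⟨hMinv a ha f hf.1, Lp.mem_Lp_iff_eLpNorm_lt_top.2 ((eLpNorm_toAEEqFun_mul_le m a f).trans_lt
      (ENNReal.mul_lt_top ENNReal.ofReal_lt_top (Lp.mem_Lp_iff_eLpNorm_lt_top.1 hf.2)))⟩
  refine ⟨inf_le_right, ⟨?_, fun _ f hf => ⟨?_, hf.1⟩⟩, hinv⟩
  · rintro rfl
    -- Sequential closedness alone does not give weak-star closedness. The bridge is `L²`: weak-star
    -- limit points lie in the `L²` closure, and the first multiplier argument with exponents `2`
    -- and `∞` returns them to the subspace.
    have hD : IsClosedUnderDominatedLimits ∞ m (M ⊓ Lp.LpSubmodule ℂ ℂ ∞ m) := by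
      intro g f F hg hF hgF hlim
      refine ⟨hMcl.isClosedUnderDominatedLimits hp hMp g f F (fun n => (hg n).1)
        (hF.mono_exponent le_top) hgF hlim, Lp.mem_Lp_iff_memLp.2 ?_⟩
      refine hF.mono' f.aestronglyMeasurable ?_
      filter_upwards [ae_all_iff.2 hgF, hlim] with x hx hl
      exact le_of_tendsto' hl.norm hx
    refine @isClosed_of_closure_subset _ (weakStarTopology m) _ fun f hf => ?_
    exact hm.mem_of_mem_lpClosure hA hφ two_ne_zero hD inf_le_right hinv
      (inf_le_right.trans fun g hg => Lp.antitone le_top hg) f.2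
      (mem_lpClosure_two_of_mem_closure_weakStar hf)
  · exact hMcl.2 (ne_top_of_lt hpq)
      (lpClosure_mono (fun _ h => h.1) (lpClosure_subset_of_exponent_le hpq.le hf))

end UniformAlgebra

/-! ### The correspondence. -/

theorem theorem3p1 {X : Type*} [TopologicalSpace X] [CompactSpace X] [T2Space X]
    [MeasurableSpace X] [BorelSpace X]
    (A : Subalgebra ℂ C(X, ℂ)) (hA : UniformAlgebra.IsUniformAlgebra A)
    (φ : A →ₐ[ℂ] ℂ)
    (hφ : FiniteDimensional ℝ (vectorSpan ℝ (UniformAlgebra.representingMeasures φ)))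
    (m : Measure X) [IsFiniteMeasure m] (hm : UniformAlgebra.IsCoreMeasure φ m)
    (p q : ℝ≥0∞) (hp : 0 < p) (hpq : p < q) :
    ∃ e : UniformAlgebra.closedInvariantSubspaces A p m ≃
        UniformAlgebra.closedInvariantSubspaces A q m,
      ∀ M : UniformAlgebra.closedInvariantSubspaces A p m,
        (e M : Submodule ℂ (X →ₘ[m] ℂ)) =
          (M : Submodule ℂ (X →ₘ[m] ℂ)) ⊓ Lp.LpSubmodule ℂ ℂ q m ∧
        ((M : Submodule ℂ (X →ₘ[m] ℂ)) : Set (X →ₘ[m] ℂ)) =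
          UniformAlgebra.lpClosure p m
            ((e M : Submodule ℂ (X →ₘ[m] ℂ)) : Set (X →ₘ[m] ℂ)) := by
  have hprob := hm.isRepresentingMeasure.isProbabilityMeasure
  have hp' : p ≠ ∞ := ne_top_of_lt hpq
  have hq : q ≠ 0 := (hp.trans hpq).ne'
  have hclosure : ∀ M ∈ UniformAlgebra.closedInvariantSubspaces A p m,
      (M : Set (X →ₘ[m] ℂ)) = UniformAlgebra.lpClosure p m
        ((M ⊓ Lp.LpSubmodule ℂ ℂ q m : Submodule ℂ (X →ₘ[m] ℂ)) : Set (X →ₘ[m] ℂ)) :=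
    fun M hM => Set.Subset.antisymm
      (hm.subset_lpClosure_inf_Lp hA hφ hp.ne' hp' q
        (hM.2.1.isClosedUnderDominatedLimits hp.ne' hM.1) hM.1 hM.2.2)
      ((UniformAlgebra.lpClosure_mono fun _ h => h.1).trans (hM.2.1.2 hp'))
  -- The inverse of intersecting with `L^q` is closing in `L^p`: density of bounded functions gives
  -- one composite, `mem_of_mem_lpClosure` the other.
  refine ⟨⟨fun M => ⟨_, hm.inf_Lp_mem_closedInvariantSubspaces hA hφ hp.ne' hpq M.2⟩,
    fun N => ⟨_, UniformAlgebra.lpClosureSubmodule_mem_closedInvariantSubspaces hp' N.2.2.2⟩,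
    fun M => Subtype.ext (SetLike.coe_injective (hclosure M M.2).symm), fun N => Subtype.ext ?_⟩,
    fun M => ⟨rfl, hclosure M M.2⟩⟩
  have hNp : (N : Submodule ℂ (X →ₘ[m] ℂ)) ≤ Lp.LpSubmodule ℂ ℂ p m := fun f hf =>
    Lp.antitone hpq.le (N.2.1 hf)
  refine le_antisymm (fun f hf => ?_) fun f hf => ⟨UniformAlgebra.subset_lpClosure hNp hf, N.2.1 hf⟩
  exact hm.mem_of_mem_lpClosure hA hφ hp.ne'
    (N.2.2.1.isClosedUnderDominatedLimits hq N.2.1) N.2.1 N.2.2.2 hNp hf.2 hf.1
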